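/- **Setting.** Let $X=(X_1,\dots,X_n)$ be real observed variables and $H=(H_1,\dots,H_m)$ hidden variables, where $H_i$ takes values in a finite set $\Omega_i$ with $|\Omega_i|\ge 2$; put $\Omega=\Omega_1\times\cdots\times\Omega_m$ and $K=|\Omega|$. Let $G$ be a DAG on the vertex set $X\cup H$ in which no edge leaves an observed variable, and let the joint distribution $\mathbb P(X,H)$ be Markov with respect to $G$, i.e. $\mathbb P(X,H)=\prod_v\mathbb P(v\mid \mathrm{pa}(v))$. Let $\Gamma$ be the bipartite graph formed by the edges of $G$ from $H$ to $X$, $\mathrm{ne}_\Gamma(H_i)\subseteq X$ the set of observed children of $H_i$, and $A\in\{0,1\}^{n\times m}$ the adjacency matrix of $\Gamma$. For $S\subseteq X$, the mixture oracle $\mathsf{MixOracle}(S)$ returns, in an arbitrary enumeration, the distinct distributions $C(S,1),\dots,C(S,k(S))$ among $\mathbb P(S\mid H=h)$, $h\in\Omega$, their number $k(S)$, and their weights $\pi(S,j)=\sum_{h:\,\mathbb P(S\mid H=h)=C(S,j)}\mathbb P(H=h)$. **Assumptions.** 1. Every hidden variable has at least one observed child. 2. (No twins) $\mathrm{ne}_\Gamma(H_i)\ne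 \mathrm{ne}_\Gamma(H_j)$ for $i\neq j$. 3. (Maximality) There is no model $(G',\mathbb P(X,H'))$ of the above kind, Markov and without twins, that is obtained by splitting a hidden variable, i.e. such that $(G,\mathbb P(X,H))$ arises from it by merging two hidden variables into a single one that takes the pairs of their values. 4. (Nondegeneracy) $\mathbb P(H=h)>0$ for all $h\in\Omega$; and for all $S\subseteq X$ and distinct configurations $a\neq b$ of $\mathrm{pa}(S)$, $\mathbb P(S\mid \mathrm{pa}(S)=a)\neq\mathbb P(S\mid \mathrm{pa}(S)=b)$. 5. (Subset condition, SSC) $\mathrm{ne}_\Gamma(H_i)\not\subseteq \mathrm{ne}_\Gamma(H_j)$ for $i\ne j$. **Theorem.** Under these assumptions, $(\Gamma,\mathbb P(H))$ is determined by $\mathbb P(X)$ and the answers of $\mathsf{MixOracle}(S)$, $S\subseteq X$, up to relabelling the hidden variables and the values of each of them: there is a map, not depending on the model, that sends $\mathbb P(X)$ and these answers to the number $m$, the sizes $|\Omega_i|$, the graph $\Gamma$ and the probability table of $H$, up to such a relabelling. Furthermore, there is a single algorithm that, for every $n$ and every such model for which in addition the columns of $A$ are linearly independent, outputs this reconstruction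 in a number of steps bounded by a polynomial in $n$ and $K$. Here an algorithm is a program for a random access machine which operates on natural numbers by addition and subtraction and can ask the oracle for $k(S)$, for the weight $\pi(S,j)$ (a real number that it can store and copy), and for whether the marginal over $T\subseteq S$ of $C(S,j)$ equals $C(T,l)$. -/

import Mathlib

/-- A latent variable model with `n` real observed variables and finitely many discrete hidden
variables: a DAG on the observed (`Sum.inl`) and hidden (`Sum.inr`) variables in which no edge
leaves an observed variable, and a joint law of `(X, H)`. The `i`-th hidden variable takes values
in `Fin (dim i)`. -/
structure LatentModel (n : ℕ) where
  m : ℕ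
  dim : Fin m → ℕ
  two_le_dim : ∀ i, 2 ≤ dim i
  G : Digraph (Fin n ⊕ Fin m)
  acyclic : ∀ v, ¬ Relation.TransGen G.Adj v v
  observed_sink : ∀ x v, ¬ G.Adj (Sum.inl x) v
  law : MeasureTheory.Measure ((Fin n → ℝ) × (∀ i, Fin (dim i)))
  isProb : MeasureTheory.IsProbabilityMeasure law

namespace LatentModel

variable {n : ℕ}

/-- The space `Ω = Ω₁ × ⋯ × Ω_m` of joint states of the hidden variables. -/
abbrev States (M : LatentModel n) : Type := ∀ i, Fin (M.dim i)

/-- The parents of a vertex; all of them are hidden, since no edge leaves an observed variable. -/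
def pa (M : LatentModel n) (v : Fin n ⊕ Fin M.m) : Set (Fin M.m) :=
  {i | M.G.Adj (Sum.inr i) v}

/-- The parents of a set of observed variables. -/
def paSet (M : LatentModel n) (S : Finset (Fin n)) : Set (Fin M.m) :=
  ⋃ x ∈ S, M.pa (Sum.inl x)

/-- The neighbourhood of a hidden variable in the bipartite graph `Γ`. -/
def nbhd (M : LatentModel n) (i : Fin M.m) : Set (Fin n) :=
  {x | M.G.Adj (Sum.inr i) (Sum.inl x)}

/-- The event that the hidden variables in `P` take the values prescribed by `h`. -/
def event (M : LatentModel n) (P : Set (Fin M.m)) (h : M.States) :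
    Set ((Fin n → ℝ) × M.States) :=
  {ω | ∀ i ∈ P, ω.2 i = h i}

/-- The Markov property: the joint law factorizes as the product over all vertices `v` of
the conditional laws of `v` given its parents. -/
def Markov (M : LatentModel n) : Prop :=
  ∀ (h : M.States) (B : Fin n → Set ℝ), (∀ x, MeasurableSet (B x)) →
    M.law {ω | (∀ x, ω.1 x ∈ B x) ∧ ω.2 = h} =
      (∏ x, ProbabilityTheory.cond M.law (M.event (M.pa (Sum.inl x)) h) {ω | ω.1 x ∈ B x}) *
      ∏ i, ProbabilityTheory.cond M.law (M.event (M.pa (Sum.inr i)) h) {ω | ω.2 i = h i}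

/-- The law of `X`. -/
noncomputable def obsLaw (M : LatentModel n) : MeasureTheory.Measure (Fin n → ℝ) :=
  M.law.map Prod.fst

/-- `P(H = h)`. -/
noncomputable def hiddenProb (M : LatentModel n) (h : M.States) : ℝ :=
  M.law.real {ω | ω.2 = h}

/-- The conditional law of the observed variables in `S`, given that the hidden variables in `P`
take the values prescribed by `h`. -/
noncomputable def condLaw (M : LatentModel n) (S : Finset (Fin n)) (P : Set (Fin M.m))
    (h : M.States) : MeasureTheory.Measure (S → ℝ) :=
  (ProbabilityTheory.cond M.law (M.event P h)).map (fun ω => S.restrict ω.1)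

/-- The law of `S` given `H = h`. -/
noncomputable def component (M : LatentModel n) (S : Finset (Fin n)) (h : M.States) :
    MeasureTheory.Measure (S → ℝ) :=
  M.condLaw S Set.univ h

/-- Distinct hidden variables have distinct neighbourhoods. -/
def NoTwins (M : LatentModel n) : Prop :=
  ∀ i j, i ≠ j → M.nbhd i ≠ M.nbhd j

/-- `M'` arises from `M` by splitting one hidden variable into a pair `p, q`; equivalently, `M`
arises from `M'` by merging `p` and `q` into one variable that takes the pairs of their values.
Here `f` sends each hidden variable of `M'` to the one it is merged into, and `e` identifies the
joint states, variable by variable. -/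
def IsSplitOf (M' M : LatentModel n) : Prop :=
  ∃ (p q : Fin M'.m) (f : Fin M'.m → Fin M.m) (e : M'.States ≃ M.States),
    p ≠ q ∧
    Function.Surjective f ∧
    (∀ i j, f i = f j ↔ i = j ∨ (i = p ∧ j = q) ∨ (i = q ∧ j = p)) ∧
    (∀ i j, i ≠ j → (M.G.Adj (Sum.inr i) (Sum.inr j) ↔
      ∃ i' j', f i' = i ∧ f j' = j ∧ M'.G.Adj (Sum.inr i') (Sum.inr j'))) ∧
    (∀ i x, M.G.Adj (Sum.inr i) (Sum.inl x) ↔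
      ∃ i', f i' = i ∧ M'.G.Adj (Sum.inr i') (Sum.inl x)) ∧
    (∀ i h h', e h i = e h' i ↔ ∀ i', f i' = i → h i' = h' i') ∧
    M.law = M'.law.map (fun ω => (ω.1, e ω.2))

/-- No hidden variable can be split so that the Markov property and the absence of twins
are kept. -/
def Maximal (M : LatentModel n) : Prop :=
  ¬ ∃ M' : LatentModel n, M'.Markov ∧ M'.IsSplitOf M ∧ M'.NoTwins

/-- Every joint hidden state has positive probability, and distinct configurations of the parents
of `S` induce distinct conditional laws of `S`. -/
def Nondegenerate (M : LatentModel n) : Prop :=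
  (∀ h, 0 < M.hiddenProb h) ∧
  ∀ (S : Finset (Fin n)) (a b : M.States), (∃ i ∈ M.paSet S, a i ≠ b i) →
    M.condLaw S (M.paSet S) a ≠ M.condLaw S (M.paSet S) b

/-- The subset condition (SSC). -/
def SubsetCondition (M : LatentModel n) : Prop :=
  ∀ i j, i ≠ j → ¬ M.nbhd i ⊆ M.nbhd j

/-- The standing assumptions on the model. -/
structure Admissible (M : LatentModel n) : Prop where
  markov : M.Markov
  /-- Every hidden variable has an observed child. -/
  nbhd_nonempty : ∀ i, (M.nbhd i).Nonempty
  noTwins : M.NoTwins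
  maximal : M.Maximal
  nondegenerate : M.Nondegenerate
  ssc : M.SubsetCondition

open Classical in
/-- The adjacency matrix of `Γ`. -/
noncomputable def adjMatrix (M : LatentModel n) : Matrix (Fin n) (Fin M.m) ℝ :=
  fun x i => if x ∈ M.nbhd i then 1 else 0

end LatentModel

/-- The answers of a mixture oracle: for each set `S` of observed variables, the number of
components of the mixture over `S`, and the weights and components in some enumeration. -/
structure MixOracle (n : ℕ) where
  k : Finset (Fin n) → ℕ
  weight : ∀ S, Fin (k S) → ℝ
  comp : ∀ S : Finset (Fin n), Fin (k S) → MeasureTheory.Measure (S → ℝ)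

/-- The oracle answers correctly for `M`: over each `S` it enumerates, without repetition, the
distinct laws `P(S | H = h)`, and the weight of a component is the total probability of the hidden
states that induce it. -/
def MixOracle.IsOracleFor {n : ℕ} (O : MixOracle n) (M : LatentModel n) : Prop :=
  ∀ S, Function.Injective (O.comp S) ∧
    Set.range (O.comp S) = {ν | ∃ h, 0 < M.hiddenProb h ∧ ν = M.component S h} ∧
    ∀ j, O.weight S j = M.law.real {ω | M.component S ω.2 = O.comp S j}

/-- A bipartite graph between `n` observed and `m` hidden variables, together with the numbers of
values of the hidden variables and a joint probability table. -/
structure Reconstruction (n : ℕ) where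
  m : ℕ
  dim : Fin m → ℕ
  adj : Fin n → Fin m → Prop
  prob : (∀ i, Fin (dim i)) → ℝ

/-- `R` is `(Γ, P(H))`, up to relabelling the hidden variables and the values of each of them. -/
def Reconstruction.Recovers {n : ℕ} (R : Reconstruction n) (M : LatentModel n) : Prop :=
  ∃ (σ : Fin R.m ≃ Fin M.m) (τ : ∀ i, Fin (R.dim i) ≃ Fin (M.dim (σ i))),
    (∀ x i, R.adj x i ↔ x ∈ M.nbhd (σ i)) ∧
    ∀ h : M.States, R.prob (fun i => (τ i).symm (h (σ i))) = M.hiddenProb h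

/-! ### A machine model

A random access machine with oracle access, presented as a small imperative language. The memory
consists of two-dimensional arrays of natural numbers and of real numbers. Natural numbers can be
added and subtracted (with truncation); real numbers can only be obtained from the oracle and
copied. -/

namespace Machine

/-- `nat a i j` and `real a i j` are the cells `(i, j)` of the `a`-th arrays. -/
structure State where
  nat : ℕ → ℕ → ℕ → ℕ
  real : ℕ → ℕ → ℕ → ℝ

inductive Expr where
  | lit (c : ℕ)
  | read (a : ℕ) (i j : Expr)
  | add (e₁ e₂ : Expr)
  | sub (e₁ e₂ : Expr)

def Expr.eval (s : State) : Expr → ℕ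
  | .lit c => c
  | .read a i j => s.nat a (i.eval s) (j.eval s)
  | .add e₁ e₂ => e₁.eval s + e₂.eval s
  | .sub e₁ e₂ => e₁.eval s - e₂.eval s

def State.setNat (s : State) (a i j v : ℕ) : State where
  nat := fun a' i' j' => if a' = a ∧ i' = i ∧ j' = j then v else s.nat a' i' j'
  real := s.real

noncomputable def State.setReal (s : State) (a i j : ℕ) (v : ℝ) : State where
  nat := s.nat
  real := fun a' i' j' => if a' = a ∧ i' = i ∧ j' = j then v else s.real a' i' j'

/-- The set of observed variables whose indicator is stored in row `i` of the array `a`. -/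
def State.readSet (n : ℕ) (s : State) (a i : ℕ) : Finset (Fin n) :=
  Finset.univ.filter fun x : Fin n => s.nat a i x ≠ 0

/-- Programs. In the three oracle queries, a set of observed variables is passed as row `r` of the
array `b`, and `c` is the index of a component over that set; the answer is written to the cell
`(i, j)` of the array `a`. -/
inductive Program where
  | skip
  | assign (a : ℕ) (i j e : Expr)
  | copyReal (a : ℕ) (i j : Expr) (a' : ℕ) (i' j' : Expr)
  | queryCount (a : ℕ) (i j : Expr) (b : ℕ) (r : Expr)
  | queryWeight (a : ℕ) (i j : Expr) (b : ℕ) (r c : Expr)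
  | queryMarginal (a : ℕ) (i j : Expr) (b : ℕ) (r c : Expr) (b' : ℕ) (r' c' : Expr)
  | seq (p q : Program)
  | cond (e : Expr) (p q : Program)
  | while (e : Expr) (p : Program)

/-- The weight of the `c`-th component over `S` (`0` if there is no such component). -/
noncomputable def weightAnswer {n : ℕ} (O : MixOracle n) (S : Finset (Fin n)) (c : ℕ) : ℝ :=
  if h : c < O.k S then O.weight S ⟨c, h⟩ else 0

open Classical in
/-- `1` if `T ⊆ S` and the marginal over `T` of the `c`-th component over `S` is the
`d`-th component over `T`, and `0` otherwise. -/
noncomputable def marginalAnswer {n : ℕ} (O : MixOracle n) (S : Finset (Fin n)) (c : ℕ)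
    (T : Finset (Fin n)) (d : ℕ) : ℕ :=
  if ∃ (hTS : T ⊆ S) (hc : c < O.k S) (hd : d < O.k T),
      (O.comp S ⟨c, hc⟩).map (Finset.restrict₂ (π := fun _ => ℝ) hTS) = O.comp T ⟨d, hd⟩
    then 1 else 0

/-- `Run O p s t s'`: with oracle `O`, the program `p` started in state `s` halts in state `s'`
after `t` steps. An oracle query costs `n + 1` steps, every other instruction and every test of a
condition one step. -/
inductive Run {n : ℕ} (O : MixOracle n) : Program → State → ℕ → State → Prop
  | skip (s : State) : Run O .skip s 1 s
  | assign (s : State) (a : ℕ) (i j e : Expr) :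
      Run O (.assign a i j e) s 1 (s.setNat a (i.eval s) (j.eval s) (e.eval s))
  | copyReal (s : State) (a : ℕ) (i j : Expr) (a' : ℕ) (i' j' : Expr) :
      Run O (.copyReal a i j a' i' j') s 1
        (s.setReal a (i.eval s) (j.eval s) (s.real a' (i'.eval s) (j'.eval s)))
  | queryCount (s : State) (a : ℕ) (i j : Expr) (b : ℕ) (r : Expr) :
      Run O (.queryCount a i j b r) s (n + 1)
        (s.setNat a (i.eval s) (j.eval s) (O.k (s.readSet n b (r.eval s))))
  | queryWeight (s : State) (a : ℕ) (i j : Expr) (b : ℕ) (r c : Expr) :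
      Run O (.queryWeight a i j b r c) s (n + 1)
        (s.setReal a (i.eval s) (j.eval s)
          (weightAnswer O (s.readSet n b (r.eval s)) (c.eval s)))
  | queryMarginal (s : State) (a : ℕ) (i j : Expr) (b : ℕ) (r c : Expr)
      (b' : ℕ) (r' c' : Expr) :
      Run O (.queryMarginal a i j b r c b' r' c') s (n + 1)
        (s.setNat a (i.eval s) (j.eval s)
          (marginalAnswer O (s.readSet n b (r.eval s)) (c.eval s)
            (s.readSet n b' (r'.eval s)) (c'.eval s)))
  | seq {p q : Program} {s₁ s₂ s₃ : State} {t₁ t₂ : ℕ} :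
      Run O p s₁ t₁ s₂ → Run O q s₂ t₂ s₃ → Run O (.seq p q) s₁ (t₁ + t₂) s₃
  | condTrue {e : Expr} {p q : Program} {s s' : State} {t : ℕ} :
      e.eval s ≠ 0 → Run O p s t s' → Run O (.cond e p q) s (t + 1) s'
  | condFalse {e : Expr} {p q : Program} {s s' : State} {t : ℕ} :
      e.eval s = 0 → Run O q s t s' → Run O (.cond e p q) s (t + 1) s'
  | whileDone {e : Expr} {p : Program} {s : State} :
      e.eval s = 0 → Run O (.while e p) s 1 s
  | whileStep {e : Expr} {p : Program} {s₁ s₂ s₃ : State} {t₁ t₂ : ℕ} :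
      e.eval s₁ ≠ 0 → Run O p s₁ t₁ s₂ → Run O (.while e p) s₂ t₂ s₃ →
      Run O (.while e p) s₁ (t₁ + t₂ + 1) s₃

/-- The initial state: the number `n` of observed variables is stored in the first cell, and all
other cells are zero. -/
def initial (n : ℕ) : State where
  nat := fun a i j => if a = 0 ∧ i = 0 ∧ j = 0 then n else 0
  real := fun _ _ _ => 0

open Classical in
/-- The final state `s` contains `R`: the number of hidden variables, their numbers of values, the
adjacency matrix, and the probability table as a list of rows, each of which holds a joint state
and its probability, with every joint state listed exactly once. -/
def State.Outputs {n : ℕ} (s : State) (R : Reconstruction n) : Prop :=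
  s.nat 0 0 0 = R.m ∧
  (∀ i : Fin R.m, s.nat 1 0 i = R.dim i) ∧
  (∀ (x : Fin n) (i : Fin R.m), s.nat 2 x i = if R.adj x i then 1 else 0) ∧
  ∃ row : (∀ i, Fin (R.dim i)) ≃ Fin (∏ i, R.dim i),
    ∀ h, (∀ i : Fin R.m, s.nat 3 (row h) i = h i) ∧ s.real 0 0 (row h) = R.prob h

end Machine

/-! Given `H = h`, the observed variables are independent and each depends only on its parents, so
P(S | H = h) is a function of the restriction of h to pa(S); nondegeneracy makes this function
injective (`component_eq_iff`). Since every hidden variable has an observed child, the components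
over all of X correspond bijectively to the hidden states and their weights are the entries of the
table of H. Comparing marginals over S reveals whether two unknown states agree on pa(S)
(`MixOracle.Labelling`). What remains is to recover the product structure of the set of states.

Take component 0 as origin. The observed variables over which another component differs from it form
the union of the neighbourhoods of those hidden variables in which the two states differ. By SSC the
neighbourhoods form an antichain, so the minimal nonempty unions are the single neighbourhoods, and
each of these arises only from states that differ from the origin in that one variable
(`minimal_iff`, `only_iff_diffSet_eq`). This yields the hidden variables, Γ, the numbers of values,
and names for the values along each axis through the origin.

By SSC again, every other hidden variable has a child outside the neighbourhood of H_j, so two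
components have the same marginal over its complement exactly when their states agree off H_j
(`index_compl_eq_iff`). A move in such a direction j ≠ t does not change H_t, so the names for H_t
spread from its axis to all components, with one pass per direction (`exec_floodCmd`).

The search consists of nested counting loops of lengths n, K and m ≤ K, hence takes polynomial time.
The reconstruction map reads off the final state of the same program. -/

namespace LatentModel

/-! ### Conditional laws of the observed variables -/

open MeasureTheory ProbabilityTheory

variable {n : ℕ}

attribute [instance] LatentModel.isProb

theorem measurableSet_event (M : LatentModel n) (P : Set (Fin M.m)) (h : M.States) :
    MeasurableSet (M.event P h) := by
  have : M.event P h = Prod.snd ⁻¹' {g : M.States | ∀ i ∈ P, g i = h i} := rfl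
  rw [this]
  exact measurable_snd (MeasurableSet.of_discrete)

theorem event_univ (M : LatentModel n) (h : M.States) :
    M.event Set.univ h = {ω | ω.2 = h} := by
  ext ω
  simp [event, funext_iff]

theorem law_event_ne_zero {M : LatentModel n} (hM : M.Nondegenerate) (P : Set (Fin M.m))
    (h : M.States) : M.law (M.event P h) ≠ 0 := by
  intro h0
  have hsub : {ω : (Fin n → ℝ) × M.States | ω.2 = h} ⊆ M.event P h := by
    rintro ω rfl i _
    rfl
  have := hM.1 h
  simp [hiddenProb, Measure.real, measure_mono_null hsub h0] at this

theorem isProbabilityMeasure_cond {M : LatentModel n} (hM : M.Nondegenerate)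
    (P : Set (Fin M.m)) (h : M.States) : IsProbabilityMeasure (cond M.law (M.event P h)) :=
  cond_isProbabilityMeasure (law_event_ne_zero hM P h)

/-- Given `H = h`, the observed variables are independent, and each of them depends on its parents
only. -/
theorem cond_rect {M : LatentModel n} (hM : M.Markov) (hN : M.Nondegenerate) (h : M.States)
    (B : Fin n → Set ℝ) (hB : ∀ x, MeasurableSet (B x)) :
    cond M.law (M.event Set.univ h) {ω | ∀ x, ω.1 x ∈ B x} =
      ∏ x, cond M.law (M.event (M.pa (Sum.inl x)) h) {ω | ω.1 x ∈ B x} := by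
  have h1 := hM h B hB
  -- Without constraints on X the factorization expresses P(H = h) as the hidden product alone,
  -- which then cancels when conditioning.
  have h2 := hM h (fun _ => Set.univ) (fun _ => MeasurableSet.univ)
  have h3 : ∀ x : Fin n, cond M.law (M.event (M.pa (Sum.inl x)) h)
      {ω : (Fin n → ℝ) × M.States | ω.1 x ∈ (Set.univ : Set ℝ)} = 1 := fun x => by
    have := isProbabilityMeasure_cond hN (M.pa (Sum.inl x)) h
    simp
  rw [Finset.prod_congr rfl fun x _ => h3 x, Finset.prod_const_one, one_mul] at h2
  simp only [Set.mem_univ, implies_true, true_and] at h2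
  have hE : M.event Set.univ h ∩ {ω | ∀ x, ω.1 x ∈ B x} =
      {ω | (∀ x, ω.1 x ∈ B x) ∧ ω.2 = h} := by
    rw [event_univ]
    ext ω
    simp [and_comm]
  have hne := law_event_ne_zero hN Set.univ h
  rw [cond_apply (M.measurableSet_event _ _), hE, h1, ← h2]
  rw [event_univ] at hne ⊢
  rw [mul_comm, mul_assoc, ENNReal.mul_inv_cancel hne (measure_ne_top _ _), mul_one]

theorem measurable_restrict_fst (M : LatentModel n) (S : Finset (Fin n)) :
    Measurable (fun ω : (Fin n → ℝ) × M.States => S.restrict ω.1) :=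
  (Finset.measurable_restrict S).comp measurable_fst

/-- Both sides agree on rectangles: a rectangle over S is padded by the whole line outside S, where
the conditional probabilities are one. -/
theorem component_eq_pi {M : LatentModel n} (hM : M.Markov) (hN : M.Nondegenerate)
    (S : Finset (Fin n)) (h : M.States) :
    M.component S h = Measure.pi fun x : S =>
      (cond M.law (M.event (M.pa (Sum.inl x.1)) h)).map (fun ω => ω.1 x.1) := by
  classical
  have hp : ∀ x : S, IsProbabilityMeasure
      ((cond M.law (M.event (M.pa (Sum.inl x.1)) h)).map (fun ω => ω.1 x.1)) := fun x => by
    have := isProbabilityMeasure_cond hN (M.pa (Sum.inl x.1)) h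
    exact Measure.isProbabilityMeasure_map (by fun_prop)
  refine (Measure.pi_eq fun s hs => ?_).symm
  rw [component, condLaw, Measure.map_apply (M.measurable_restrict_fst S)
    (MeasurableSet.univ_pi hs)]
  let B : Fin n → Set ℝ := fun x => if hx : x ∈ S then s ⟨x, hx⟩ else Set.univ
  have hB : ∀ x, MeasurableSet (B x) := fun x => by
    by_cases hx : x ∈ S
    · simpa [B, hx] using hs ⟨x, hx⟩
    · simp [B, hx]
  have hpre : (fun ω : (Fin n → ℝ) × M.States => S.restrict ω.1) ⁻¹' Set.univ.pi s =
      {ω | ∀ x, ω.1 x ∈ B x} := by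
    ext ω
    simp only [Set.mem_preimage, Set.mem_pi, Set.mem_univ, true_imp_iff, Set.mem_ofPred_eq]
    constructor
    · intro H x
      by_cases hx : x ∈ S
      · simpa [B, hx] using H ⟨x, hx⟩
      · simp [B, hx]
    · intro H x
      simpa [B] using H x.1
  rw [hpre, cond_rect hM hN h B hB, ← Finset.prod_subset (Finset.subset_univ S),
    ← Finset.prod_coe_sort S]
  · refine Finset.prod_congr rfl fun x _ => ?_
    rw [Measure.map_apply (by fun_prop) (hs x)]
    have : B x.1 = s x := by simp [B]
    rw [this]
    rfl
  · intro x _ hx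
    have := isProbabilityMeasure_cond hN (M.pa (Sum.inl x)) h
    simp [B, hx]

theorem component_congr {M : LatentModel n} (hM : M.Markov) (hN : M.Nondegenerate)
    {S : Finset (Fin n)} {g h : M.States} (hgh : ∀ i ∈ M.paSet S, g i = h i) :
    M.component S g = M.component S h := by
  rw [component_eq_pi hM hN, component_eq_pi hM hN]
  congr 1
  funext x
  have : M.event (M.pa (Sum.inl x.1)) g = M.event (M.pa (Sum.inl x.1)) h := by
    ext ω
    refine forall₂_congr fun i hi => ?_
    rw [hgh i (Set.mem_biUnion x.2 hi)]
  rw [this]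

/-- Bridges nondegeneracy, which conditions on pa(S), and the oracle, which conditions on all of H.
The law given pa(S) is an average of the components of the states that agree with h on pa(S), and
these components all coincide. -/
theorem condLaw_paSet {M : LatentModel n} (hM : M.Markov) (hN : M.Nondegenerate)
    (S : Finset (Fin n)) (h : M.States) : M.condLaw S (M.paSet S) h = M.component S h := by
  classical
  ext A hA
  set f : (Fin n → ℝ) × M.States → (S → ℝ) := fun ω => S.restrict ω.1 with hf
  have hfm : Measurable f := M.measurable_restrict_fst S
  have hfA : MeasurableSet (f ⁻¹' A) := hfm hA
  set T : Finset M.States := Finset.univ.filter fun g => ∀ i ∈ M.paSet S, g i = h i with hT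
  have hev : M.event (M.paSet S) h = Prod.snd ⁻¹' (T : Set M.States) := by
    ext ω
    simp [event, hT]
  have hms : ∀ g ∈ T, MeasurableSet
      ((Prod.snd : (Fin n → ℝ) × M.States → M.States) ⁻¹' {g}) :=
    fun g _ => measurable_snd (MeasurableSet.of_discrete)
  have hsum1 := sum_measure_preimage_singleton (μ := M.law.restrict (f ⁻¹' A)) T hms
  have hsum2 := sum_measure_preimage_singleton (μ := M.law) T hms
  have hcomp : ∀ g ∈ T, M.law.restrict (f ⁻¹' A) (Prod.snd ⁻¹' {g}) =
      M.law (Prod.snd ⁻¹' {g}) * M.component S h A := fun g hg => by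
    have hgh : M.component S h = M.component S g :=
      component_congr hM hN fun i hi => ((Finset.mem_filter.1 hg).2 i hi).symm
    have he : M.event Set.univ g = Prod.snd ⁻¹' {g} := by rw [event_univ]; rfl
    have hne := law_event_ne_zero hN Set.univ g
    rw [hgh, component, condLaw, Measure.map_apply hfm hA,
      cond_apply (M.measurableSet_event _ _), Measure.restrict_apply (hms g hg)]
    rw [he] at hne ⊢
    rw [← mul_assoc, ENNReal.mul_inv_cancel hne (measure_ne_top _ _), one_mul]
  rw [Finset.sum_congr rfl hcomp, ← Finset.sum_mul, hsum2, Measure.restrict_apply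
    (measurable_snd (MeasurableSet.of_discrete)), ← hev] at hsum1
  rw [condLaw, Measure.map_apply hfm hA, cond_apply (M.measurableSet_event _ _), ← hsum1,
    ← mul_assoc, ENNReal.inv_mul_cancel (law_event_ne_zero hN _ h) (measure_ne_top _ _), one_mul]

/-- The Markov property gives one direction, nondegeneracy the other. This is all that the rest of
the proof uses about the laws of the components. -/
theorem component_eq_iff {M : LatentModel n} (hM : M.Markov) (hN : M.Nondegenerate)
    {S : Finset (Fin n)} {g h : M.States} :
    M.component S g = M.component S h ↔ ∀ i ∈ M.paSet S, g i = h i := by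
  refine ⟨fun H => ?_, component_congr hM hN⟩
  by_contra! hne
  refine hN.2 S g h hne ?_
  rw [condLaw_paSet hM hN, condLaw_paSet hM hN, H]

theorem map_component (M : LatentModel n) {S T : Finset (Fin n)} (hTS : T ⊆ S) (h : M.States) :
    (M.component S h).map (Finset.restrict₂ (π := fun _ => ℝ) hTS) = M.component T h := by
  have hm : Measurable (Finset.restrict₂ (π := fun _ : Fin n => ℝ) hTS) :=
    Finset.measurable_restrict₂ hTS
  exact Measure.map_map hm (M.measurable_restrict_fst S)

theorem mem_paSet {M : LatentModel n} {S : Finset (Fin n)} {i : Fin M.m} :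
    i ∈ M.paSet S ↔ ∃ x ∈ S, x ∈ M.nbhd i := by
  simp [paSet, pa, nbhd]

theorem mem_paSet_univ {M : LatentModel n} (hM : M.Admissible) (i : Fin M.m) :
    i ∈ M.paSet Finset.univ := by
  obtain ⟨x, hx⟩ := hM.nbhd_nonempty i
  exact mem_paSet.2 ⟨x, Finset.mem_univ x, hx⟩

end LatentModel

/-! ### The oracle's answers in terms of hidden states -/

open MeasureTheory LatentModel Machine in
/-- A labelling of the components over all observed variables by the joint hidden states, together
with the numbering of their marginals. -/
structure MixOracle.Labelling {n : ℕ} (O : MixOracle n) (M : LatentModel n) where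
  state : ℕ → M.States
  surj : ∀ h, ∃ c < O.k Finset.univ, state c = h
  inj : ∀ c < O.k Finset.univ, ∀ c' < O.k Finset.univ, state c = state c' → c = c'
  index : Finset (Fin n) → ℕ → ℕ
  index_lt : ∀ S, ∀ c < O.k Finset.univ, index S c < O.k Finset.univ
  marginal_iff : ∀ S, ∀ c < O.k Finset.univ, ∀ d,
    marginalAnswer O Finset.univ c S d ≠ 0 ↔ d = index S c
  index_eq_iff : ∀ S, ∀ c < O.k Finset.univ, ∀ c' < O.k Finset.univ,
    index S c = index S c' ↔ ∀ i ∈ M.paSet S, state c i = state c' i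
  weight_eq : ∀ c < O.k Finset.univ, weightAnswer O Finset.univ c = M.hiddenProb (state c)

open MeasureTheory LatentModel Machine in
theorem MixOracle.IsOracleFor.exists_labelling {n : ℕ} {O : MixOracle n} {M : LatentModel n}
    (hO : O.IsOracleFor M) (hM : M.Admissible) : Nonempty (O.Labelling M) := by
  classical
  have hpos := hM.nondegenerate.1
  have hrange : ∀ S j, ∃ h, O.comp S j = M.component S h := fun S j => by
    have : O.comp S j ∈ Set.range (O.comp S) := ⟨j, rfl⟩
    rw [(hO S).2.1] at this
    obtain ⟨h, -, hh⟩ := this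
    exact ⟨h, hh⟩
  have hmem : ∀ S h, ∃ j, O.comp S j = M.component S h := fun S h => by
    have : M.component S h ∈ Set.range (O.comp S) := by
      rw [(hO S).2.1]
      exact ⟨h, hpos h, rfl⟩
    exact this
  choose st hst using hrange Finset.univ
  choose ix hix using hmem
  have heq : ∀ {S g h}, M.component S g = M.component S h ↔ ∀ i ∈ M.paSet S, g i = h i :=
    component_eq_iff hM.markov hM.nondegenerate
  have hequniv : ∀ {g h}, M.component Finset.univ g = M.component Finset.univ h ↔ g = h :=
    fun {g h} => by
      rw [heq]
      exact ⟨fun H => funext fun i => H i (mem_paSet_univ hM i), fun H i _ => H ▸ rfl⟩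
  let h₀ : M.States := fun i => ⟨0, by have := M.two_le_dim i; omega⟩
  let state : ℕ → M.States := fun c => if hc : c < O.k Finset.univ then st ⟨c, hc⟩ else h₀
  have hstate : ∀ c (hc : c < O.k Finset.univ),
      O.comp Finset.univ ⟨c, hc⟩ = M.component Finset.univ (state c) := fun c hc => by
    simp [state, hc, hst]
  -- Every component over S is a marginal of one over all of X, so a search through the numbers
  -- below K meets every component over S.
  have hle : ∀ S, O.k S ≤ O.k Finset.univ := fun S => by
    have hsurj : Function.Surjective fun c => ix S (st c) := fun d => by
      obtain ⟨h, hh⟩ := hrange S d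
      refine ⟨ix Finset.univ h, (hO S).1 ?_⟩
      have : st (ix Finset.univ h) = h := hequniv.1 (by rw [← hst, hix])
      rw [hix, this, hh]
    simpa using Fintype.card_le_of_surjective _ hsurj
  refine ⟨⟨state, fun h => ?_, fun c hc c' hc' H => ?_, fun S c => (ix S (state c)).1,
    fun S c hc => ?_, fun S c hc d => ?_, fun S c hc c' hc' => ?_, fun c hc => ?_⟩⟩
  · refine ⟨(ix Finset.univ h).1, (ix Finset.univ h).2, hequniv.1 ?_⟩
    rw [← hstate _ (ix Finset.univ h).2, Fin.eta, hix]
  · have := (hO Finset.univ).1 ((hstate c hc).trans (H ▸ (hstate c' hc').symm))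
    simpa using this
  · exact (ix S (state c)).2.trans_le (hle S)
  · have hcond : (∃ (hTS : S ⊆ Finset.univ) (hc : c < O.k Finset.univ) (hd : d < O.k S),
        (O.comp Finset.univ ⟨c, hc⟩).map (Finset.restrict₂ (π := fun _ => ℝ) hTS) =
          O.comp S ⟨d, hd⟩) ↔ d = (ix S (state c)).1 := by
      constructor
      · rintro ⟨hTS, hc, hd, H⟩
        rw [hstate c hc, map_component, ← hix] at H
        exact (congrArg Fin.val ((hO S).1 H)).symm
      · rintro rfl
        refine ⟨Finset.subset_univ S, hc, (ix S (state c)).2, ?_⟩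
        rw [hstate c hc, map_component, ← hix]
    unfold marginalAnswer
    rw [← hcond]
    split_ifs with H
    · exact iff_of_true one_ne_zero H
    · exact iff_of_false (fun h => h rfl) H
  · rw [← heq, ← hix, ← hix, Fin.val_inj]
    exact ⟨fun H => by rw [H], fun H => (hO S).1 H⟩
  · simp only [weightAnswer, hc, dif_pos, (hO Finset.univ).2.2, hstate c hc, hequniv]
    rfl

/-! ### Programs with counting loops -/

namespace Machine

variable {n : ℕ}

/-- The cell `(0, 0)` of the array `a`, used as a variable. -/
def var (a : ℕ) : Expr := .read a (.lit 0) (.lit 0)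

/-- An expression that vanishes if and only if the two expressions agree. -/
def dist (e₁ e₂ : Expr) : Expr := .add (.sub e₁ e₂) (.sub e₂ e₁)

/-- Programs all of whose loops are counting loops: `loop v b c` runs `c` with the variable `v`
ranging over the natural numbers below the value of the variable `b`. -/
inductive Cmd where
  | skip
  | assign (a : ℕ) (i j e : Expr)
  | queryCount (a : ℕ) (i j : Expr) (b : ℕ) (r : Expr)
  | queryWeight (a : ℕ) (i j : Expr) (b : ℕ) (r c : Expr)
  | queryMarginal (a : ℕ) (i j : Expr) (b : ℕ) (r c : Expr) (b' : ℕ) (r' c' : Expr)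
  | seq (p q : Cmd)
  | cond (e : Expr) (p q : Cmd)
  | loop (v b : ℕ) (p : Cmd)

namespace Cmd

/-- By truncation, the loop test `b - v` is nonzero exactly while `v < b`. -/
def compile : Cmd → Program
  | skip => .skip
  | assign a i j e => .assign a i j e
  | queryCount a i j b r => .queryCount a i j b r
  | queryWeight a i j b r c => .queryWeight a i j b r c
  | queryMarginal a i j b r c b' r' c' => .queryMarginal a i j b r c b' r' c'
  | seq p q => .seq p.compile q.compile
  | cond e p q => .cond e p.compile q.compile
  | loop v b p => .seq (.assign v (.lit 0) (.lit 0) (.lit 0))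
      (.while (.sub (var b) (var v))
        (.seq p.compile (.assign v (.lit 0) (.lit 0) (.add (var v) (.lit 1)))))

/-- A loop reads its bound once on entry, whereas the compiled `while` reads it before each
iteration. The two agree when the body writes neither the counter nor the bound, which is what
`run_compile` assumes. -/
noncomputable def exec (O : MixOracle n) : Cmd → State → State
  | skip, s => s
  | assign a i j e, s => s.setNat a (i.eval s) (j.eval s) (e.eval s)
  | queryCount a i j b r, s =>
      s.setNat a (i.eval s) (j.eval s) (O.k (s.readSet n b (r.eval s)))
  | queryWeight a i j b r c, s =>
      s.setReal a (i.eval s) (j.eval s) (weightAnswer O (s.readSet n b (r.eval s)) (c.eval s))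
  | queryMarginal a i j b r c b' r' c', s =>
      s.setNat a (i.eval s) (j.eval s)
        (marginalAnswer O (s.readSet n b (r.eval s)) (c.eval s)
          (s.readSet n b' (r'.eval s)) (c'.eval s))
  | seq p q, s => exec O q (exec O p s)
  | cond e p q, s => if e.eval s ≠ 0 then exec O p s else exec O q s
  | loop v b p, s =>
      Nat.rec (s.setNat v 0 0 0) (fun k s' => (exec O p s').setNat v 0 0 (k + 1)) (s.nat b 0 0)

/-- The arrays of natural numbers that a program may change. -/
def writes : Cmd → List ℕ
  | skip => []
  | assign a _ _ _ => [a]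
  | queryCount a _ _ _ _ => [a]
  | queryWeight _ _ _ _ _ _ => []
  | queryMarginal a _ _ _ _ _ _ _ _ => [a]
  | seq p q => p.writes ++ q.writes
  | cond _ p q => p.writes ++ q.writes
  | loop v _ p => v :: p.writes

/-- The variables that bound the loops of a program. -/
def bounds : Cmd → List ℕ
  | seq p q => p.bounds ++ q.bounds
  | cond _ p q => p.bounds ++ q.bounds
  | loop _ b p => b :: p.bounds
  | _ => []

/-- No loop changes its own counter in its body. -/
def CountersSafe : Cmd → Bool
  | seq p q => p.CountersSafe && q.CountersSafe
  | cond _ p q => p.CountersSafe && q.CountersSafe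
  | loop v _ p => !p.writes.contains v && p.CountersSafe
  | _ => true

/-- A bound for the running time, as a polynomial in a common bound of the number of observed
variables and of the lengths of the loops. -/
noncomputable def cost : Cmd → Polynomial ℕ
  | seq p q => p.cost + q.cost
  | cond _ p q => p.cost + q.cost + 1
  | loop _ _ p => .X * (p.cost + 2) + 2
  | _ => .X + 1

end Cmd

theorem setNat_nat_of_ne {s : State} {a a' i j v : ℕ} (h : a' ≠ a) :
    (s.setNat a i j v).nat a' = s.nat a' := by
  funext i' j'
  simp [State.setNat, h]

theorem setNat_nat_self (s : State) (a i j v i' j' : ℕ) :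
    (s.setNat a i j v).nat a i' j' = if i' = i ∧ j' = j then v else s.nat a i' j' := by
  simp [State.setNat]

theorem setNat_real (s : State) (a i j v : ℕ) : (s.setNat a i j v).real = s.real := rfl

namespace Cmd

theorem exec_loop_eq (O : MixOracle n) (v b : ℕ) (p : Cmd) (s : State) :
    exec O (loop v b p) s = Nat.rec (s.setNat v 0 0 0)
      (fun k s' => (exec O p s').setNat v 0 0 (k + 1)) (s.nat b 0 0) := by
  rw [exec]

theorem exec_nat_of_notMem (O : MixOracle n) {a : ℕ} :
    ∀ (c : Cmd), a ∉ c.writes → ∀ s, (exec O c s).nat a = s.nat a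
  | skip, _, s => by simp [exec]
  | assign a' i j e, h, s => by
      rw [exec]; exact setNat_nat_of_ne (by simpa [writes] using h)
  | queryCount a' i j b r, h, s => by
      rw [exec]; exact setNat_nat_of_ne (by simpa [writes] using h)
  | queryWeight a' i j b r c, h, s => by rw [exec]; rfl
  | queryMarginal a' i j b r c b' r' c', h, s => by
      rw [exec]; exact setNat_nat_of_ne (by simpa [writes] using h)
  | seq p q, h, s => by
      simp only [writes, List.mem_append, not_or] at h
      rw [exec, exec_nat_of_notMem O q h.2, exec_nat_of_notMem O p h.1]
  | cond e p q, h, s => by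
      simp only [writes, List.mem_append, not_or] at h
      rw [exec]
      split_ifs
      · exact exec_nat_of_notMem O p h.1 s
      · exact exec_nat_of_notMem O q h.2 s
  | loop v b p, h, s => by
      simp only [writes, List.mem_cons, not_or] at h
      rw [exec_loop_eq]
      induction s.nat b 0 0 with
      | zero => exact setNat_nat_of_ne h.1
      | succ k ih =>
        simp only
        rw [setNat_nat_of_ne h.1, exec_nat_of_notMem O p h.2, ih]

/-- Reasoning about loops by means of an invariant. The arrays that the loop does not write
keep their contents. -/
theorem exec_loop_induct {O : MixOracle n} {v b : ℕ} {p : Cmd} {s : State}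
    (I : ℕ → State → Prop) (h0 : I 0 (s.setNat v 0 0 0))
    (hstep : ∀ k s', k < s.nat b 0 0 → s'.nat v 0 0 = k →
      (∀ a, a ∉ (loop v b p).writes → s'.nat a = s.nat a) → I k s' →
      I (k + 1) ((exec O p s').setNat v 0 0 (k + 1))) :
    I (s.nat b 0 0) (exec O (loop v b p) s) := by
  rw [exec_loop_eq]
  -- The invariant is carried along together with the value of the counter and the frame condition,
  -- on which `hstep` may rely.
  have key : ∀ k ≤ s.nat b 0 0, ∀ s', s' = (Nat.rec (s.setNat v 0 0 0)
      (fun k s' => (exec O p s').setNat v 0 0 (k + 1)) k : State) →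
      s'.nat v 0 0 = k ∧ (∀ a, a ∉ (loop v b p).writes → s'.nat a = s.nat a) ∧ I k s' := by
    intro k
    induction k with
    | zero =>
      rintro - s' rfl
      refine ⟨by simp [setNat_nat_self], fun a ha => setNat_nat_of_ne ?_, h0⟩
      simp only [writes, List.mem_cons, not_or] at ha
      exact ha.1
    | succ k ih =>
      rintro hk s' rfl
      obtain ⟨h1, h2, h3⟩ := ih (by omega) _ rfl
      refine ⟨by simp [setNat_nat_self], fun a ha => ?_, hstep k _ (by omega) h1 h2 h3⟩
      have ha' := ha
      simp only [writes, List.mem_cons, not_or] at ha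
      simp only
      rw [setNat_nat_of_ne ha.1, exec_nat_of_notMem O p ha.2, h2 a ha']
  exact (key _ le_rfl _ rfl).2.2

/-- A loop that fills cells of the array `a` with values that do not depend on the order of the
iterations: in the `k`-th iteration, the cells in `P k`. -/
theorem exec_loop_cells {O : MixOracle n} {v b : ℕ} {p : Cmd} {s : State} (a : ℕ)
    (P : ℕ → ℕ → ℕ → Prop) [∀ k i j, Decidable (P k i j)] (F : ℕ → ℕ → ℕ)
    (ha : a ≠ v)
    (hstep : ∀ k s', k < s.nat b 0 0 → s'.nat v 0 0 = k →
      (∀ a, a ∉ (loop v b p).writes → s'.nat a = s.nat a) →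
      (∀ i j, (¬ ∃ k' < k, P k' i j) → s'.nat a i j = s.nat a i j) →
      ∀ i j, (exec O p s').nat a i j = if P k i j then F i j else s'.nat a i j) (i j : ℕ) :
    (exec O (loop v b p) s).nat a i j =
      if ∃ k < s.nat b 0 0, P k i j then F i j else s.nat a i j := by
  refine exec_loop_induct (fun N s' => ∀ i j, s'.nat a i j =
      if ∃ k < N, P k i j then F i j else s.nat a i j) ?_ ?_ i j
  · intro i j
    simp [setNat_nat_of_ne ha]
  · intro k s' hk h1 h2 h3 i j
    rw [setNat_nat_of_ne ha, hstep k s' hk h1 h2 (fun i j hij => by rw [h3, if_neg hij]), h3]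
    by_cases h : P k i j
    · rw [if_pos h, if_pos ⟨k, by omega, h⟩]
    · rw [if_neg h]
      refine if_congr ⟨?_, ?_⟩ rfl rfl
      · rintro ⟨k', hk', h'⟩
        exact ⟨k', by omega, h'⟩
      · rintro ⟨k', hk', h'⟩
        refine ⟨k', ?_, h'⟩
        rcases Nat.lt_succ_iff_lt_or_eq.1 hk' with h'' | rfl
        · exact h''
        · exact absurd h' h

/-- The compiled program computes `exec` within the time `cost`. -/
theorem run_compile (O : MixOracle n) {B : ℕ} (hn : n ≤ B) :
    ∀ (c : Cmd) (s : State), c.CountersSafe = true →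
      (∀ b ∈ c.bounds, b ∉ c.writes ∧ s.nat b 0 0 ≤ B) →
      ∃ t ≤ c.cost.eval B, Run O c.compile s t (exec O c s) := by
  intro c
  induction c with
  | skip =>
    intro s _ _
    exact ⟨1, by simp [cost], by rw [exec]; exact .skip s⟩
  | assign a i j e =>
    intro s _ _
    exact ⟨1, by simp [cost], by rw [exec]; exact .assign s a i j e⟩
  | queryCount a i j b r =>
    intro s _ _
    exact ⟨n + 1, by simp [cost, hn], by rw [exec]; exact .queryCount s a i j b r⟩
  | queryWeight a i j b r c =>
    intro s _ _
    exact ⟨n + 1, by simp [cost, hn], by rw [exec]; exact .queryWeight s a i j b r c⟩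
  | queryMarginal a i j b r c b' r' c' =>
    intro s _ _
    exact ⟨n + 1, by simp [cost, hn], by rw [exec]; exact .queryMarginal s a i j b r c b' r' c'⟩
  | seq p q ihp ihq =>
    intro s hs hb
    simp only [CountersSafe, Bool.and_eq_true] at hs
    simp only [bounds, writes, List.mem_append, not_or] at hb
    obtain ⟨t₁, ht₁, h₁⟩ := ihp s hs.1 fun b h => ⟨(hb b (.inl h)).1.1, (hb b (.inl h)).2⟩
    obtain ⟨t₂, ht₂, h₂⟩ := ihq (exec O p s) hs.2 fun b h => ⟨(hb b (.inr h)).1.2, by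
      rw [exec_nat_of_notMem O p (hb b (.inr h)).1.1]; exact (hb b (.inr h)).2⟩
    refine ⟨t₁ + t₂, ?_, ?_⟩
    · simp only [cost, Polynomial.eval_add]
      omega
    · rw [exec]
      exact .seq h₁ h₂
  | cond e p q ihp ihq =>
    intro s hs hb
    simp only [CountersSafe, Bool.and_eq_true] at hs
    simp only [bounds, writes, List.mem_append, not_or] at hb
    obtain ⟨t₁, ht₁, h₁⟩ := ihp s hs.1 fun b h => ⟨(hb b (.inl h)).1.1, (hb b (.inl h)).2⟩
    obtain ⟨t₂, ht₂, h₂⟩ := ihq s hs.2 fun b h => ⟨(hb b (.inr h)).1.2, (hb b (.inr h)).2⟩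
    rw [exec]
    simp only [cost, Polynomial.eval_add, Polynomial.eval_one]
    by_cases he : e.eval s = 0
    · rw [if_neg (by simpa using he)]
      exact ⟨t₂ + 1, by omega, .condFalse he h₂⟩
    · rw [if_pos he]
      exact ⟨t₁ + 1, by omega, .condTrue he h₁⟩
  | loop v b p ih =>
    intro s hs hb
    simp only [CountersSafe, Bool.and_eq_true, Bool.not_eq_true', List.contains_eq_mem,
      decide_eq_false_iff_not] at hs
    have hbv : b ∉ v :: p.writes := (hb b (by simp [bounds])).1
    have hbB : s.nat b 0 0 ≤ B := (hb b (by simp [bounds])).2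
    simp only [List.mem_cons, not_or] at hbv
    let W : Program := .while (.sub (var b) (var v))
      (.seq p.compile (.assign v (.lit 0) (.lit 0) (.add (var v) (.lit 1))))
    let it : ℕ → State := fun k => Nat.rec (s.setNat v 0 0 0)
      (fun k s' => (exec O p s').setNat v 0 0 (k + 1)) k
    have hframe : ∀ k a, a ≠ v → a ∉ p.writes → (it k).nat a = s.nat a := by
      intro k a hav hap
      induction k with
      | zero => exact setNat_nat_of_ne hav
      | succ k ihk =>
        show ((exec O p (it k)).setNat v 0 0 (k + 1)).nat a = _
        rw [setNat_nat_of_ne hav, exec_nat_of_notMem O p hap, ihk]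
    have hcount : ∀ k, (it k).nat v 0 0 = k := by
      intro k
      cases k <;> simp [it, setNat_nat_self]
    -- Induction on the number of remaining iterations, since `Run` peels off the first iteration
    -- while `exec` peels off the last.
    have key : ∀ k ≤ s.nat b 0 0,
        ∃ t ≤ k * (p.cost.eval B + 2) + 1, Run O W (it (s.nat b 0 0 - k)) t
          (it (s.nat b 0 0)) := by
      intro k
      induction k with
      | zero =>
        intro _
        refine ⟨1, by omega, .whileDone ?_⟩
        simp [Expr.eval, var, hframe _ b hbv.1 hbv.2, hcount]
      | succ k ihk =>
        intro hk
        obtain ⟨t₂, ht₂, h₂⟩ := ihk (by omega)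
        set l := s.nat b 0 0 - (k + 1) with hl
        have hl' : s.nat b 0 0 - k = l + 1 := by omega
        rw [hl'] at h₂
        obtain ⟨t₁, ht₁, h₁⟩ := ih (it l) hs.2 fun b' hb' => by
          have := hb b' (by simp [bounds, hb'])
          simp only [writes, List.mem_cons, not_or] at this
          exact ⟨this.1.2, by rw [hframe l b' this.1.1 this.1.2]; exact this.2⟩
        refine ⟨(t₁ + 1) + t₂ + 1, ?_, .whileStep ?_ (.seq h₁ ?_) h₂⟩
        · rw [add_mul]
          omega
        · simp only [Expr.eval, var, hframe _ b hbv.1 hbv.2, hcount]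
          omega
        · have : it (l + 1) = (exec O p (it l)).setNat v
              ((Expr.lit 0).eval (exec O p (it l))) ((Expr.lit 0).eval (exec O p (it l)))
              ((Expr.add (var v) (.lit 1)).eval (exec O p (it l))) := by
            simp only [Expr.eval, var, exec_nat_of_notMem O p hs.1, hcount]
            rfl
          rw [this]
          exact .assign _ v _ _ _
    obtain ⟨t, ht, h⟩ := key _ le_rfl
    rw [Nat.sub_self] at h
    refine ⟨1 + t, ?_, ?_⟩
    · have : s.nat b 0 0 * (p.cost.eval B + 2) ≤ B * (p.cost.eval B + 2) :=
        Nat.mul_le_mul_right _ hbB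
      simp only [cost, Polynomial.eval_add, Polynomial.eval_mul, Polynomial.eval_X,
        Polynomial.eval_ofNat]
      omega
    · rw [exec_loop_eq]
      exact .seq (.assign s v (.lit 0) (.lit 0) (.lit 0)) h

end Cmd

end Machine

namespace Machine

variable {n : ℕ}

/-! ### The algorithm

Besides the input and output arrays, the program uses the following arrays of natural numbers.

* `20`, `21`: the numbers `n` of observed variables and `K` of components over all of them;
* `10`: the singletons in the rows below `n`, the set of all observed variables in row `n`;
* `12`: the numbers of the marginals over single variables of the components;
* `13`: the sets of observed variables over which a component differs from the component `0`;
* `15`: indicates which of these sets fails to be a subset of which;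
* `14`: indicates the sets that properly contain another nonempty one;
* `17`: marks the components that have been assigned to a hidden variable;
* `11`: the complements of the neighbourhoods of the hidden variables;
* `18`: the numbers of the marginals over these complements;
* `30` to `33`: loop counters;
* `40`: the answer to a query. -/

namespace Cmd

open _root_.Machine.Expr in
/-- Stores the singletons and the set of all observed variables. -/
def setsCmd : Cmd :=
  loop 30 20 (seq (assign 10 (var 20) (var 30) (lit 1)) (assign 10 (var 30) (var 30) (lit 1)))

open _root_.Machine.Expr in
/-- Determines the number of components. -/
def countCmd : Cmd :=
  seq (queryCount 21 (lit 0) (lit 0) 10 (var 20)) (assign 0 (lit 0) (lit 0) (lit 0))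

open _root_.Machine.Expr in
/-- Stores in the array `a` the numbers of the marginals over the sets in the array `b`. -/
def indexCmd (b a w : ℕ) : Cmd :=
  loop 30 w (loop 31 21 (loop 32 21
    (seq (queryMarginal 40 (lit 0) (lit 0) 10 (var 20) (var 31) b (var 30) (var 32))
      (cond (var 40) (assign a (var 30) (var 31) (var 32)) skip))))

-- The double truncated subtraction turns a distance into an indicator, so that rows of array `13`
-- can be compared entrywise and complemented.
open _root_.Machine.Expr in
def diffCmd : Cmd :=
  loop 30 21 (loop 31 20 (assign 13 (var 30) (var 31)
    (sub (lit 1) (sub (lit 1)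
      (dist (read 12 (var 31) (var 30)) (read 12 (var 31) (lit 0)))))))

-- On indicators, the truncated difference is nonzero exactly at the elements of the first set that
-- are missing from the second.
open _root_.Machine.Expr in
def subsetCmd : Cmd :=
  loop 30 21 (loop 31 21 (loop 32 20
    (cond (sub (read 13 (var 30) (var 32)) (read 13 (var 31) (var 32)))
      (assign 15 (var 30) (var 31) (lit 1)) skip)))

-- The test is a conjunction: `1 - e` is nonzero only if all three summands of `e` vanish. The
-- summand `1 - c'` excludes component 0, whose difference set is empty.
open _root_.Machine.Expr in
def nonminimalCmd : Cmd :=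
  loop 30 21 (loop 31 21
    (cond (sub (lit 1) (add (read 15 (var 31) (var 30))
        (add (sub (lit 1) (read 15 (var 30) (var 31))) (sub (lit 1) (var 31)))))
      (assign 14 (var 30) (lit 0) (lit 1)) skip))

open _root_.Machine.Expr in
/-- Enumerates the components that differ from the component `0` over the same observed variables
as the current one. -/
def labelCmd : Cmd :=
  loop 31 21 (cond (add (read 15 (var 30) (var 31)) (read 15 (var 31) (var 30))) skip
    (seq (assign 17 (var 31) (lit 0) (lit 1))
      -- The number of values found so far serves as the next free label.
      (seq (assign 3 (var 31) (var 0) (read 1 (lit 0) (var 0)))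
        (assign 1 (lit 0) (var 0) (add (read 1 (lit 0) (var 0)) (lit 1))))))

open _root_.Machine.Expr in
/-- Stores the neighbourhood of the current hidden variable and its complement. -/
def nbhdCmd : Cmd :=
  loop 32 20 (seq (assign 2 (var 32) (var 0) (read 13 (var 30) (var 32)))
    (assign 11 (var 0) (var 32) (sub (lit 1) (read 13 (var 30) (var 32)))))

open _root_.Machine.Expr in
/-- Adds a hidden variable. -/
def newCmd : Cmd :=
  -- One value, with label 0, is known beforehand: that of component 0.
  seq (assign 1 (lit 0) (var 0) (lit 1))
    (seq labelCmd (seq nbhdCmd (assign 0 (lit 0) (lit 0) (add (var 0) (lit 1)))))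

open _root_.Machine.Expr in
/-- Finds the hidden variables. -/
def hiddenCmd : Cmd :=
  -- Marking component 0 keeps its empty difference set from being taken for a neighbourhood.
  seq (assign 17 (lit 0) (lit 0) (lit 1))
    (loop 30 21 (cond (sub (lit 1) (add (read 14 (var 30) (lit 0)) (read 17 (var 30) (lit 0))))
      newCmd skip))

open _root_.Machine.Expr in
/-- Copies the value of the hidden variable `30` to components that agree up to the hidden
variable `33`. -/
def spreadCmd : Cmd :=
  loop 31 21 (loop 32 21
    (cond (add (dist (read 18 (var 33) (var 31)) (read 18 (var 33) (var 32)))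
        -- Nothing is copied when the source holds 0 (unset, or the label of the origin's value), or
        -- when the direction is the variable itself.
        (add (sub (lit 1) (read 3 (var 32) (var 30))) (sub (lit 1) (dist (var 30) (var 33)))))
      skip (assign 3 (var 31) (var 30) (read 3 (var 32) (var 30)))))

/-- One pass per direction suffices: any state is reached from the axis of the current variable by
changing the other coordinates one at a time, in the order of the list. -/
def floodCmd : Cmd := loop 30 0 (loop 33 0 spreadCmd)

open _root_.Machine.Expr in
def weightCmd : Cmd :=
  loop 30 21 (queryWeight 0 (lit 0) (var 30) 10 (var 20) (var 30))

/-! ### Marginals, difference sets and minimality -/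

theorem exec_setsCmd (O : MixOracle n) (s : State) (i x : ℕ) :
    (exec O setsCmd s).nat 10 i x =
      if ∃ k < s.nat 20 0 0, x = k ∧ (i = s.nat 20 0 0 ∨ i = k) then 1 else s.nat 10 i x := by
  classical
  refine exec_loop_cells 10 (fun k i x => x = k ∧ (i = s.nat 20 0 0 ∨ i = k)) (fun _ _ => 1)
    (by decide) ?_ i x
  intro k s' hk h1 h2 _ i x
  have h20 : s'.nat 20 = s.nat 20 := h2 20 (by decide)
  simp only [exec, Expr.eval, var, setNat_nat_self, h20, h1,
    setNat_nat_of_ne (a := 10) (a' := 30) (by decide)]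
  grind

/-- For each row and component exactly one candidate is confirmed by the oracle, and it lies below
`K`. Hence the innermost loop writes its cell exactly once. -/
theorem exec_indexCmd (O : MixOracle n) (s : State) {b a w K : ℕ} (hK : s.nat 21 0 0 = K)
    (hfull : s.readSet n 10 (s.nat 20 0 0) = Finset.univ) (f : Finset (Fin n) → ℕ → ℕ)
    (hf : ∀ S, ∀ c < K, f S c < K ∧ ∀ d, marginalAnswer O Finset.univ c S d ≠ 0 ↔ d = f S c)
    (ha : a ∉ [10, 20, 21, 30, 31, 32, 40, b]) (hb : b ∉ [30, 31, 32, 40]) {r c : ℕ}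
    (hr : r < s.nat w 0 0) (hc : c < K) :
    (exec O (indexCmd b a w) s).nat a r c = f (s.readSet n b r) c := by
  classical
  simp only [List.mem_cons, List.not_mem_nil, or_false, not_or] at ha hb
  subst hK
  obtain ⟨ha10, ha20, ha21, ha30, ha31, ha32, ha40, hab⟩ := ha
  obtain ⟨hb30, hb31, hb32, hb40⟩ := hb
  rw [indexCmd, exec_loop_cells a (fun r i j => i = r ∧ j < s.nat 21 0 0)
    (fun i j => f (s.readSet n b i) j) ha30]
  · rw [if_pos ⟨r, hr, rfl, hc⟩]
  intro r s₁ hr hr1 hfr1 _ i j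
  have e21 : s₁.nat 21 = s.nat 21 := hfr1 _ (by simp [writes, Ne.symm ha21])
  rw [exec_loop_cells a (fun c i j => i = r ∧ j = c)
    (fun i j => f (s.readSet n b i) j) ha31]
  · rw [e21]
    refine if_congr ⟨?_, ?_⟩ rfl rfl
    · rintro ⟨k, hk, rfl, rfl⟩
      exact ⟨rfl, hk⟩
    · rintro ⟨rfl, hk⟩
      exact ⟨j, hk, rfl, rfl⟩
  intro c s₂ hc hc1 hfr2 _ i j
  rw [e21] at hc
  have e21' : s₂.nat 21 = s.nat 21 :=
    (hfr2 _ (by simp [writes, Ne.symm ha21])).trans e21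
  rw [exec_loop_cells a (fun d i j => i = r ∧ j = c ∧ d = f (s.readSet n b r) c)
    (fun i j => f (s.readSet n b i) j) ha32]
  · rw [e21']
    refine if_congr ⟨?_, ?_⟩ rfl rfl
    · rintro ⟨k, hk, rfl, rfl, _⟩
      exact ⟨rfl, rfl⟩
    · rintro ⟨rfl, rfl⟩
      exact ⟨_, (hf _ _ hc).1, rfl, rfl, rfl⟩
  intro d s₃ hd hd1 hfr3 _ i j
  have g : ∀ a', a' ≠ a → a' ≠ 30 → a' ≠ 31 → a' ≠ 32 → a' ≠ 40 → s₃.nat a' = s.nat a' := by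
    intro a' h0 h1 h2 h3 h4
    rw [hfr3 _ (by simp [writes, *]), hfr2 _ (by simp [writes, *]), hfr1 _ (by simp [writes, *])]
  have g10 := g 10 (Ne.symm ha10) (by decide) (by decide) (by decide) (by decide)
  have g20 := g 20 (Ne.symm ha20) (by decide) (by decide) (by decide) (by decide)
  have gb := g b (Ne.symm hab) hb30 hb31 hb32 hb40
  have g31 : s₃.nat 31 0 0 = c := by rw [hfr3 _ (by simp [writes, Ne.symm ha31]), hc1]
  have g30 : s₃.nat 30 0 0 = r := by
    rw [hfr3 _ (by simp [writes, Ne.symm ha30]), hfr2 _ (by simp [writes, Ne.symm ha30]), hr1]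
  have gset : s₃.readSet n 10 (s₃.nat 20 0 0) = Finset.univ := by
    rw [← hfull, State.readSet, State.readSet, g10, g20]
  have gset' : s₃.readSet n b r = s.readSet n b r := by
    rw [State.readSet, State.readSet, gb]
  have key := (hf (s.readSet n b r) c hc).2 d
  simp only [exec, Expr.eval, var, setNat_nat_self, g31, g30, hd1, gset, gset', and_self, if_true]
  by_cases h : d = f (s.readSet n b r) c
  · rw [if_pos (key.2 h), setNat_nat_self, setNat_nat_of_ne ha40,
      setNat_nat_of_ne (by decide), setNat_nat_of_ne (by decide), setNat_nat_of_ne (by decide),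
      g30, g31, hd1]
    grind
  · rw [if_neg (fun h' => h (key.1 h')), setNat_nat_of_ne ha40, if_neg (fun h' => h h'.2.2)]

theorem exec_diffCmd (O : MixOracle n) (s : State) {c x : ℕ} (hc : c < s.nat 21 0 0)
    (hx : x < s.nat 20 0 0) :
    (exec O diffCmd s).nat 13 c x = if s.nat 12 x c = s.nat 12 x 0 then 0 else 1 := by
  classical
  rw [diffCmd, exec_loop_cells 13 (fun c i j => i = c ∧ j < s.nat 20 0 0)
    (fun i j => if s.nat 12 j i = s.nat 12 j 0 then 0 else 1) (by decide)]
  · rw [if_pos ⟨c, hc, rfl, hx⟩]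
  intro c s₁ hc hc1 hfr1 _ i j
  rw [exec_loop_cells 13 (fun x i j => i = c ∧ j = x)
    (fun i j => if s.nat 12 j i = s.nat 12 j 0 then 0 else 1) (by decide)]
  · rw [hfr1 20 (by decide)]
    exact if_congr (by grind) rfl rfl
  intro x s₂ hx hx1 hfr2 _ i j
  have g12 : s₂.nat 12 = s.nat 12 := by rw [hfr2 12 (by decide), hfr1 12 (by decide)]
  have g30 : s₂.nat 30 0 0 = c := by rw [hfr2 30 (by decide), hc1]
  simp only [exec, Expr.eval, var, dist, setNat_nat_self, g12, g30, hx1]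
  grind

theorem exec_subsetCmd (O : MixOracle n) (s : State) (h15 : ∀ i j, s.nat 15 i j = 0)
    {c c' : ℕ} (hc : c < s.nat 21 0 0) (hc' : c' < s.nat 21 0 0) :
    (exec O subsetCmd s).nat 15 c c' = 0 ↔
      ∀ x < s.nat 20 0 0, s.nat 13 c x ≤ s.nat 13 c' x := by
  classical
  rw [subsetCmd, exec_loop_cells 15
    (fun c i j => i = c ∧ j < s.nat 21 0 0 ∧ ∃ x < s.nat 20 0 0, s.nat 13 j x < s.nat 13 i x)
    (fun _ _ => 1) (by decide)]
  · rw [h15, ite_eq_right_iff]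
    refine ⟨fun h x hx => not_lt.1 fun hlt => ?_, ?_⟩
    · exact one_ne_zero (h ⟨c, hc, rfl, hc', x, hx, hlt⟩)
    · rintro h ⟨_, _, rfl, _, x, hx, hlt⟩
      exact absurd hlt (not_lt.2 (h x hx))
  intro c s₁ hc hc1 hfr1 _ i j
  rw [exec_loop_cells 15
    (fun c' i j => i = c ∧ j = c' ∧ ∃ x < s.nat 20 0 0, s.nat 13 j x < s.nat 13 i x)
    (fun _ _ => 1) (by decide)]
  · rw [hfr1 21 (by decide)]
    refine if_congr ⟨?_, ?_⟩ rfl rfl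
    · rintro ⟨k, hk, rfl, rfl, h⟩
      exact ⟨rfl, hk, h⟩
    · rintro ⟨rfl, hk, h⟩
      exact ⟨j, hk, rfl, rfl, h⟩
  intro c' s₂ hc' hc1' hfr2 _ i j
  rw [exec_loop_cells 15
    (fun x i j => i = c ∧ j = c' ∧ s.nat 13 j x < s.nat 13 i x) (fun _ _ => 1) (by decide)]
  · rw [hfr2 20 (by decide), hfr1 20 (by decide)]
    exact if_congr (by grind) rfl rfl
  intro x s₃ hx hx1 hfr3 _ i j
  have g13 : s₃.nat 13 = s.nat 13 := by
    rw [hfr3 13 (by decide), hfr2 13 (by decide), hfr1 13 (by decide)]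
  have g30 : s₃.nat 30 0 0 = c := by rw [hfr3 30 (by decide), hfr2 30 (by decide), hc1]
  have g31 : s₃.nat 31 0 0 = c' := by rw [hfr3 31 (by decide), hc1']
  simp only [exec, Expr.eval, var, g13, g30, g31, hx1]
  split_ifs <;> (try rw [setNat_nat_self]) <;> grind

theorem exec_nonminimalCmd (O : MixOracle n) (s : State) (h14 : ∀ i j, s.nat 14 i j = 0)
    {c : ℕ} (hc : c < s.nat 21 0 0) :
    (exec O nonminimalCmd s).nat 14 c 0 = 0 ↔
      ∀ c' < s.nat 21 0 0, c' ≠ 0 → s.nat 15 c' c = 0 → s.nat 15 c c' = 0 := by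
  classical
  rw [nonminimalCmd, exec_loop_cells 14
    (fun c i j => i = c ∧ j = 0 ∧ ∃ c' < s.nat 21 0 0, c' ≠ 0 ∧ s.nat 15 c' i = 0 ∧
      s.nat 15 i c' ≠ 0)
    (fun _ _ => 1) (by decide)]
  · rw [h14, ite_eq_right_iff]
    refine ⟨fun h c' hc' h0 h1 => by_contra fun h2 => ?_, ?_⟩
    · exact one_ne_zero (h ⟨c, hc, rfl, rfl, c', hc', h0, h1, h2⟩)
    · rintro h ⟨_, _, rfl, _, c', hc', h0, h1, h2⟩
      exact absurd (h c' hc' h0 h1) h2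
  intro c s₁ hc hc1 hfr1 _ i j
  rw [exec_loop_cells 14
    (fun c' i j => i = c ∧ j = 0 ∧ c' ≠ 0 ∧ s.nat 15 c' i = 0 ∧ s.nat 15 i c' ≠ 0)
    (fun _ _ => 1) (by decide)]
  · rw [hfr1 21 (by decide)]
    exact if_congr (by grind) rfl rfl
  intro c' s₂ hc' hc1' hfr2 _ i j
  have g15 : s₂.nat 15 = s.nat 15 := by rw [hfr2 15 (by decide), hfr1 15 (by decide)]
  have g30 : s₂.nat 30 0 0 = c := by rw [hfr2 30 (by decide), hc1]
  simp only [exec, Expr.eval, var, g15, g30, hc1']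
  split_ifs <;> (try rw [setNat_nat_self]) <;> grind

end Cmd

end Machine

/-! ### Labelling values and spreading the labels -/

namespace Machine

variable {n : ℕ}

namespace Cmd

/-- `Nat.count p c'` is the rank of `c'` among the components that share the difference set of `c`;
the labels are these ranks, shifted by the initial value of the counter. -/
theorem exec_labelCmd (O : MixOracle n) (s : State) {c q K : ℕ} (hc : s.nat 30 0 0 = c)
    (hq : s.nat 0 0 0 = q) (hK : s.nat 21 0 0 = K) (p : ℕ → Prop) [DecidablePred p]
    (hp : ∀ c', p c' ↔ s.nat 15 c c' = 0 ∧ s.nat 15 c' c = 0) :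
    (∀ t, (exec O labelCmd s).nat 1 0 t =
      if t = q then s.nat 1 0 q + Nat.count p K else s.nat 1 0 t) ∧
    (∀ c', (exec O labelCmd s).nat 17 c' 0 = if c' < K ∧ p c' then 1 else s.nat 17 c' 0) ∧
    (∀ c' t, (exec O labelCmd s).nat 3 c' t =
      if t = q ∧ c' < K ∧ p c' then s.nat 1 0 q + Nat.count p c' else s.nat 3 c' t) := by
  subst hK
  refine exec_loop_induct (fun k s' =>
    (∀ t, s'.nat 1 0 t = if t = q then s.nat 1 0 q + Nat.count p k else s.nat 1 0 t) ∧
    (∀ c', s'.nat 17 c' 0 = if c' < k ∧ p c' then 1 else s.nat 17 c' 0) ∧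
    (∀ c' t, s'.nat 3 c' t =
      if t = q ∧ c' < k ∧ p c' then s.nat 1 0 q + Nat.count p c' else s.nat 3 c' t)) ?_ ?_
  · refine ⟨fun t => ?_, fun c' => ?_, fun c' t => ?_⟩ <;>
      simp +contextual [setNat_nat_of_ne]
  · rintro k s' hk hk1 hfr ⟨h1, h2, h3⟩
    have g0 : s'.nat 0 0 0 = q := by rw [hfr 0 (by decide), hq]
    have g30 : s'.nat 30 0 0 = c := by rw [hfr 30 (by decide), hc]
    have g15 : s'.nat 15 = s.nat 15 := hfr 15 (by decide)
    have hcond : s.nat 15 c k + s.nat 15 k c ≠ 0 ↔ ¬ p k := by rw [hp]; omega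
    simp only [exec, Expr.eval, var, g15, g30, hk1, hcond]
    by_cases hpk : p k
    · rw [if_neg (not_not.2 hpk)]
      refine ⟨fun t => ?_, fun c' => ?_, fun c' t => ?_⟩ <;>
        simp only [State.setNat, g0, hk1, Nat.count_succ, hpk, h1, h2, h3] <;> grind
    · rw [if_pos hpk]
      refine ⟨fun t => ?_, fun c' => ?_, fun c' t => ?_⟩ <;>
        simp only [State.setNat, Nat.count_succ, hpk, h1, h2, h3] <;> grind

theorem exec_nbhdCmd (O : MixOracle n) (s : State) {c q N : ℕ} (hc : s.nat 30 0 0 = c)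
    (hq : s.nat 0 0 0 = q) (hN : s.nat 20 0 0 = N) :
    (∀ x t, (exec O nbhdCmd s).nat 2 x t =
      if t = q ∧ x < N then s.nat 13 c x else s.nat 2 x t) ∧
    (∀ t x, (exec O nbhdCmd s).nat 11 t x =
      if t = q ∧ x < N then 1 - s.nat 13 c x else s.nat 11 t x) := by
  subst hN
  refine exec_loop_induct (fun k s' =>
    (∀ x t, s'.nat 2 x t = if t = q ∧ x < k then s.nat 13 c x else s.nat 2 x t) ∧
    (∀ t x, s'.nat 11 t x = if t = q ∧ x < k then 1 - s.nat 13 c x else s.nat 11 t x)) ?_ ?_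
  · simp [setNat_nat_of_ne]
  · rintro k s' hk hk1 hfr ⟨h1, h2⟩
    have g0 : s'.nat 0 0 0 = q := by rw [hfr 0 (by decide), hq]
    have g30 : s'.nat 30 0 0 = c := by rw [hfr 30 (by decide), hc]
    have g13 : s'.nat 13 = s.nat 13 := hfr 13 (by decide)
    refine ⟨fun x t => ?_, fun t x => ?_⟩ <;>
      simp only [exec, Expr.eval, var, State.setNat, g0, g13, g30, hk1, h1, h2] <;> grind

theorem exec_newCmd (O : MixOracle n) (s : State) {c q K N : ℕ} (hc : s.nat 30 0 0 = c)
    (hq : s.nat 0 0 0 = q) (hK : s.nat 21 0 0 = K) (hN : s.nat 20 0 0 = N)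
    (p : ℕ → Prop) [DecidablePred p]
    (hp : ∀ c', p c' ↔ s.nat 15 c c' = 0 ∧ s.nat 15 c' c = 0) :
    (exec O newCmd s).nat 0 0 0 = q + 1 ∧
    (∀ t, (exec O newCmd s).nat 1 0 t = if t = q then 1 + Nat.count p K else s.nat 1 0 t) ∧
    (∀ c', (exec O newCmd s).nat 17 c' 0 = if c' < K ∧ p c' then 1 else s.nat 17 c' 0) ∧
    (∀ c' t, (exec O newCmd s).nat 3 c' t =
      if t = q ∧ c' < K ∧ p c' then 1 + Nat.count p c' else s.nat 3 c' t) ∧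
    (∀ x t, (exec O newCmd s).nat 2 x t =
      if t = q ∧ x < N then s.nat 13 c x else s.nat 2 x t) ∧
    (∀ t x, (exec O newCmd s).nat 11 t x =
      if t = q ∧ x < N then 1 - s.nat 13 c x else s.nat 11 t x) := by
  set s₁ := exec O (assign 1 (.lit 0) (var 0) (.lit 1)) s with hs₁
  set s₂ := exec O labelCmd s₁ with hs₂
  set s₃ := exec O nbhdCmd s₂ with hs₃
  have e : exec O newCmd s = exec O (assign 0 (.lit 0) (.lit 0) (.add (var 0) (.lit 1))) s₃ := by
    simp only [newCmd, exec, hs₁, hs₂, hs₃]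
  have f₁ : ∀ a, a ≠ 1 → s₁.nat a = s.nat a := fun a ha =>
    exec_nat_of_notMem O _ (by simpa [writes] using ha) s
  have f₂ : ∀ a, a ∉ labelCmd.writes → s₂.nat a = s₁.nat a := fun a ha =>
    exec_nat_of_notMem O _ ha s₁
  have f₃ : ∀ a, a ∉ nbhdCmd.writes → s₃.nat a = s₂.nat a := fun a ha =>
    exec_nat_of_notMem O _ ha s₂
  have f₄ : ∀ a, a ≠ 0 → (exec O newCmd s).nat a = s₃.nat a := fun a ha => by
    rw [e]; exact exec_nat_of_notMem O _ (by simpa [writes] using ha) s₃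
  have h1 : ∀ t, s₁.nat 1 0 t = if t = q then 1 else s.nat 1 0 t := fun t => by
    simp [hs₁, exec, var, Expr.eval, setNat_nat_self, hq]
  obtain ⟨l1, l2, l3⟩ := exec_labelCmd O s₁ (c := c) (q := q) (K := K)
    (by rw [f₁ 30 (by decide), hc]) (by rw [f₁ 0 (by decide), hq])
    (by rw [f₁ 21 (by decide), hK]) p (by rw [f₁ 15 (by decide)]; exact hp)
  obtain ⟨b1, b2⟩ := exec_nbhdCmd O s₂ (c := c) (q := q) (N := N)
    (by rw [f₂ 30 (by decide), f₁ 30 (by decide), hc])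
    (by rw [f₂ 0 (by decide), f₁ 0 (by decide), hq])
    (by rw [f₂ 20 (by decide), f₁ 20 (by decide), hN])
  refine ⟨?_, fun t => ?_, fun c' => ?_, fun c' t => ?_, fun x t => ?_, fun t x => ?_⟩
  · rw [e]
    simp only [exec, Expr.eval, var, setNat_nat_self, and_self, if_true]
    rw [f₃ 0 (by decide), f₂ 0 (by decide), f₁ 0 (by decide), hq]
  · rw [f₄ 1 (by decide), f₃ 1 (by decide), l1, h1, h1]
    grind
  · rw [f₄ 17 (by decide), f₃ 17 (by decide), l2, f₁ 17 (by decide)]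
  · rw [f₄ 3 (by decide), f₃ 3 (by decide), l3, f₁ 3 (by decide), h1]
    simp
  · rw [f₄ 2 (by decide), b1, f₂ 2 (by decide), f₂ 13 (by decide), f₁ 2 (by decide),
      f₁ 13 (by decide)]
  · rw [f₄ 11 (by decide), b2, f₂ 11 (by decide), f₂ 13 (by decide), f₁ 11 (by decide),
      f₁ 13 (by decide)]

/-- A pass in the direction `j` keeps correct values of the hidden variable `t` and copies them to
all components that agree up to `j`. -/
theorem exec_spreadCmd (O : MixOracle n) (s : State) {t j K : ℕ} (ht : s.nat 30 0 0 = t)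
    (hj : s.nat 33 0 0 = j) (hK : s.nat 21 0 0 = K) (T : ℕ → ℕ)
    (hsound : ∀ c < K, s.nat 3 c t = 0 ∨ s.nat 3 c t = T c)
    (hcompat : t ≠ j → ∀ c < K, ∀ c' < K, s.nat 18 j c = s.nat 18 j c' → T c = T c') :
    (∀ c t', t' ≠ t → (exec O spreadCmd s).nat 3 c t' = s.nat 3 c t') ∧
    (∀ c < K, (exec O spreadCmd s).nat 3 c t = 0 ∨ (exec O spreadCmd s).nat 3 c t = T c) ∧
    (∀ c < K, s.nat 3 c t = T c → (exec O spreadCmd s).nat 3 c t = T c) ∧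
    (t ≠ j → ∀ c < K, ∀ c' < K, s.nat 18 j c = s.nat 18 j c' → s.nat 3 c' t = T c' → T c' ≠ 0 →
      (exec O spreadCmd s).nat 3 c t = T c) := by
  subst hK
  -- `A` records the pairs (target, source) already treated. The table is updated in place, so the
  -- third clause is needed: a source that was correct at the start stays correct until it is read.
  let Inv (A : ℕ → ℕ → Prop) (s' : State) : Prop :=
    (∀ c t', t' ≠ t → s'.nat 3 c t' = s.nat 3 c t') ∧
    (∀ c < s.nat 21 0 0, s'.nat 3 c t = 0 ∨ s'.nat 3 c t = T c) ∧
    (∀ c < s.nat 21 0 0, s.nat 3 c t = T c → s'.nat 3 c t = T c) ∧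
    (t ≠ j → ∀ c < s.nat 21 0 0, ∀ c' < s.nat 21 0 0, A c c' → s.nat 18 j c = s.nat 18 j c' →
      s.nat 3 c' t = T c' → T c' ≠ 0 → s'.nat 3 c t = T c)
  have key : Inv (fun c _ => c < s.nat 21 0 0) (exec O spreadCmd s) := by
    refine exec_loop_induct (fun k s' => Inv (fun c _ => c < k) s') ?_ ?_
    · simp only [Inv, setNat_nat_of_ne (a := 31) (a' := 3) (by decide)]
      exact ⟨fun _ _ _ => trivial, hsound, fun _ _ h => h, fun _ c _ c' _ h => absurd h (by omega)⟩
    intro k s₁ hk hk1 hfr1 hI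
    have e21 : s₁.nat 21 = s.nat 21 := hfr1 21 (by decide)
    have key2 := exec_loop_induct (O := O) (v := 32) (b := 21) (s := s₁)
      (p := cond (.add (dist (.read 18 (var 33) (var 31)) (.read 18 (var 33) (var 32)))
        (.add (.sub (.lit 1) (.read 3 (var 32) (var 30)))
          (.sub (.lit 1) (dist (var 30) (var 33)))))
        skip (assign 3 (var 31) (var 30) (.read 3 (var 32) (var 30))))
      (fun k' s' => Inv (fun c c' => c < k ∨ c = k ∧ c' < k') s') ?_ ?_
    · rw [e21] at key2
      obtain ⟨i1, i2, i3, i4⟩ := key2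
      simp only [Inv, setNat_nat_of_ne (a := 31) (a' := 3) (by decide)]
      refine ⟨i1, i2, i3, fun htj c hc c' hc' hck => i4 htj c hc c' hc' ?_⟩
      grind
    · obtain ⟨i1, i2, i3, i4⟩ := hI
      simp only [Inv, setNat_nat_of_ne (a := 32) (a' := 3) (by decide)]
      refine ⟨i1, i2, i3, fun htj c hc c' hc' hck => i4 htj c hc c' hc' ?_⟩
      grind
    · rintro k' s₂ hk' hk1' hfr2 ⟨i1, i2, i3, i4⟩
      rw [e21] at hk'
      have g18 : s₂.nat 18 = s.nat 18 := by rw [hfr2 18 (by decide), hfr1 18 (by decide)]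
      have g30 : s₂.nat 30 0 0 = t := by rw [hfr2 30 (by decide), hfr1 30 (by decide), ht]
      have g33 : s₂.nat 33 0 0 = j := by rw [hfr2 33 (by decide), hfr1 33 (by decide), hj]
      have g31 : s₂.nat 31 0 0 = k := by rw [hfr2 31 (by decide), hk1]
      have hcond : (s.nat 18 j k - s.nat 18 j k' + (s.nat 18 j k' - s.nat 18 j k) +
          (1 - s₂.nat 3 k' t + (1 - (t - j + (j - t)))) ≠ 0) ↔
          ¬ (s.nat 18 j k = s.nat 18 j k' ∧ s₂.nat 3 k' t ≠ 0 ∧ t ≠ j) := by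
        omega
      simp only [Inv, exec, Expr.eval, var, dist, g18, g30, g33, g31, hk1', hcond,
        setNat_nat_of_ne (a := 32) (a' := 3) (by decide)]
      by_cases h : s.nat 18 j k = s.nat 18 j k' ∧ s₂.nat 3 k' t ≠ 0 ∧ t ≠ j
      · rw [if_neg (not_not.2 h)]
        obtain ⟨h1, h2, h3⟩ := h
        have hT := hcompat h3 k hk k' hk' h1
        have hv : s₂.nat 3 k' t = T k := by
          rw [hT]
          exact (i2 k' hk').resolve_left h2
        simp only [setNat_nat_self, hv]
        refine ⟨?_, ?_, ?_, ?_⟩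
        · intro c t' htt
          rw [if_neg (fun h => htt h.2), i1 c t' htt]
        · intro c hc
          split_ifs with hck
          · exact .inr (by rw [hck.1])
          · exact i2 c hc
        · intro c hc hcT
          split_ifs with hck
          · rw [hck.1]
          · exact i3 c hc hcT
        · intro htj c hc c' hc' hA hr hc'T hT0
          split_ifs with hck
          · rw [hck.1]
          · refine i4 htj c hc c' hc' ?_ hr hc'T hT0
            grind
      · rw [if_pos h]
        refine ⟨i1, i2, i3, fun htj c hc c' hc' hA hr hc'T hT0 => ?_⟩
        by_cases hck : c < k ∨ c = k ∧ c' < k'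
        · exact i4 htj c hc c' hc' hck hr hc'T hT0
        -- The only new pair is the current one, and for it the test cannot have failed: the source
        -- still holds its correct nonzero label.
        · obtain ⟨rfl, rfl⟩ : c = k ∧ c' = k' := by omega
          refine absurd ⟨hr, ?_, htj⟩ h
          rw [i3 c' hc' hc'T]
          exact hT0
  obtain ⟨i1, i2, i3, i4⟩ := key
  exact ⟨i1, i2, i3, fun htj c hc c' hc' => i4 htj c hc c' hc' hc⟩

/-- `Reached t j c` stands for the cells of variable `t` that must be correct after the passes in
the directions below `j`; `hsucc` says that one pass gains the next layer. -/
theorem exec_floodCmd (O : MixOracle n) (s : State) {m K : ℕ} (hm : s.nat 0 0 0 = m)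
    (hK : s.nat 21 0 0 = K) (T : ℕ → ℕ → ℕ) (Reached : ℕ → ℕ → ℕ → Prop)
    (hsound : ∀ t < m, ∀ c < K, s.nat 3 c t = 0 ∨ s.nat 3 c t = T c t)
    (hcompat : ∀ t < m, ∀ j < m, t ≠ j → ∀ c < K, ∀ c' < K, s.nat 18 j c = s.nat 18 j c' →
      T c t = T c' t)
    (hzero : ∀ t < m, ∀ c < K, Reached t 0 c → s.nat 3 c t = T c t)
    (hsucc : ∀ t < m, ∀ j < m, ∀ c < K, Reached t (j + 1) c →
      ∃ c' < K, Reached t j c' ∧ (c' = c ∨ t ≠ j ∧ s.nat 18 j c = s.nat 18 j c'))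
    (hall : ∀ t < m, ∀ c < K, Reached t m c) {t c : ℕ} (ht : t < m) (hc : c < K) :
    (exec O floodCmd s).nat 3 c t = T c t := by
  subst hm hK
  have key : (∀ t < s.nat 0 0 0, ∀ c < s.nat 21 0 0, (exec O floodCmd s).nat 3 c t = T c t) ∧
      ∀ t, s.nat 0 0 0 ≤ t → ∀ c, (exec O floodCmd s).nat 3 c t = s.nat 3 c t := by
    refine exec_loop_induct (fun k s' =>
      (∀ t < k, ∀ c < s.nat 21 0 0, s'.nat 3 c t = T c t) ∧
      ∀ t, k ≤ t → ∀ c, s'.nat 3 c t = s.nat 3 c t) ?_ ?_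
    · simp [setNat_nat_of_ne]
    rintro k s₁ hk hk1 hfr1 ⟨h1, h2⟩
    have e0 : s₁.nat 0 = s.nat 0 := hfr1 0 (by decide)
    have key2 := exec_loop_induct (O := O) (v := 33) (b := 0) (s := s₁) (p := spreadCmd)
      (fun l s' => (∀ c t', t' ≠ k → s'.nat 3 c t' = s₁.nat 3 c t') ∧
        (∀ c < s.nat 21 0 0, s'.nat 3 c k = 0 ∨ s'.nat 3 c k = T c k) ∧
        ∀ c < s.nat 21 0 0, Reached k l c → s'.nat 3 c k = T c k) ?_ ?_
    · rw [e0] at key2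
      obtain ⟨i1, i2, i3⟩ := key2
      simp only [setNat_nat_of_ne (a := 30) (a' := 3) (by decide)]
      refine ⟨fun t ht c hc => ?_, fun t ht c => ?_⟩
      · rcases Nat.lt_succ_iff_lt_or_eq.1 ht with h | rfl
        · rw [i1 c t (by omega), h1 t h c hc]
        · exact i3 c hc (hall t hk c hc)
      · rw [i1 c t (by omega), h2 t (by omega)]
    · simp only [setNat_nat_of_ne (a := 33) (a' := 3) (by decide)]
      refine ⟨fun _ _ _ => trivial, fun c hc => ?_, fun c hc hr => ?_⟩
      · rw [h2 k le_rfl]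
        exact hsound k hk c hc
      · rw [h2 k le_rfl]
        exact hzero k hk c hc hr
    · rintro l s₂ hl hl1 hfr2 ⟨i1, i2, i3⟩
      rw [e0] at hl
      have g18 : s₂.nat 18 = s.nat 18 := by rw [hfr2 18 (by decide), hfr1 18 (by decide)]
      have g21 : s₂.nat 21 = s.nat 21 := by rw [hfr2 21 (by decide), hfr1 21 (by decide)]
      obtain ⟨j1, j2, j3, j4⟩ := exec_spreadCmd O s₂ (t := k) (j := l) (K := s.nat 21 0 0)
        (by rw [hfr2 30 (by decide), hk1]) hl1 (by rw [g21]) (fun c => T c k) i2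
        (by rw [g18]; exact hcompat k hk l hl)
      simp only [setNat_nat_of_ne (a := 33) (a' := 3) (by decide)]
      refine ⟨fun c t' ht' => by rw [j1 c t' ht', i1 c t' ht'], j2, fun c hc hr => ?_⟩
      obtain ⟨c', hc', hr', h⟩ := hsucc k hk l hl c hc hr
      rcases h with rfl | ⟨hkl, h18⟩
      · exact j3 c' hc (i3 c' hc hr')
      -- Label 0 is never copied and need not be: the target then holds either the default 0 or its
      -- correct label, which is 0 as well.
      · by_cases hT : T c' k = 0
        · have : T c k = 0 := by rw [hcompat k hk l hl hkl c hc c' hc' h18, hT]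
          rcases j2 c hc with h | h
          · rw [h, this]
          · exact h
        · exact j4 hkl c hc c' hc' (by rw [g18, h18]) (i3 c' hc' hr') hT
  exact key.1 t ht c hc

theorem exec_weightCmd (O : MixOracle n) (s : State) {c : ℕ} (hc : c < s.nat 21 0 0) :
    (exec O weightCmd s).real 0 0 c =
      weightAnswer O (s.readSet n 10 (s.nat 20 0 0)) c := by
  refine exec_loop_induct (fun k s' => ∀ c < k, s'.real 0 0 c =
    weightAnswer O (s.readSet n 10 (s.nat 20 0 0)) c) ?_ ?_ c hc
  · intro c hc
    omega
  · intro k s' hk hk1 hfr hI c hc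
    have hset : s'.readSet n 10 (s'.nat 20 0 0) = s.readSet n 10 (s.nat 20 0 0) := by
      rw [State.readSet, State.readSet, hfr 10 (by decide), hfr 20 (by decide)]
    simp only [setNat_real, exec, State.setReal, Expr.eval, var, hk1, hset]
    grind

end Cmd

end Machine

/-! ### Difference sets and the subset condition -/

namespace MixOracle.Labelling

open LatentModel

variable {n : ℕ} {O : MixOracle n} {M : LatentModel n}

/-- The components `c` and `0` differ in the hidden variable `i` and in no other one. -/
def Only (l : O.Labelling M) (c : ℕ) (i : Fin M.m) : Prop :=
  l.state c i ≠ l.state 0 i ∧ ∀ j, j ≠ i → l.state c j = l.state 0 j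

/-- The observed variables over which the components `c` and `0` differ. -/
def diffSet (l : O.Labelling M) (c : ℕ) : Set (Fin n) :=
  {x | ∃ i, x ∈ M.nbhd i ∧ l.state c i ≠ l.state 0 i}

theorem pos (l : O.Labelling M) : 0 < O.k Finset.univ := by
  obtain ⟨c, hc, -⟩ := l.surj (l.state 0)
  omega

theorem index_singleton_eq_iff (l : O.Labelling M) {c : ℕ} (hc : c < O.k Finset.univ)
    (x : Fin n) : l.index {x} c = l.index {x} 0 ↔ x ∉ l.diffSet c := by
  rw [l.index_eq_iff {x} c hc 0 l.pos]
  simp only [mem_paSet, diffSet, Finset.mem_singleton, exists_eq_left, Set.mem_ofPred_eq]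
  grind

/-- By SSC every `j ≠ i` has a child outside the neighbourhood of `i`, so the parents of the
complement are all hidden variables except `i`. -/
theorem index_compl_eq_iff (l : O.Labelling M) (hM : M.Admissible) {i : Fin M.m}
    {S : Finset (Fin n)} (hS : ∀ x, x ∈ S ↔ x ∉ M.nbhd i) {c c' : ℕ} (hc : c < O.k Finset.univ)
    (hc' : c' < O.k Finset.univ) :
    l.index S c = l.index S c' ↔ ∀ j, j ≠ i → l.state c j = l.state c' j := by
  rw [l.index_eq_iff S c hc c' hc']
  refine forall_congr' fun j => imp_congr_left ?_
  rw [mem_paSet]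
  constructor
  · rintro ⟨x, hx, hxj⟩ rfl
    exact (hS x).1 hx hxj
  · intro hji
    obtain ⟨x, hxj, hxi⟩ := Set.not_subset.1 (hM.ssc j i hji)
    exact ⟨x, (hS x).2 hxi, hxj⟩

theorem Only.diffSet_eq {l : O.Labelling M} {c : ℕ} {i : Fin M.m} (h : l.Only c i) :
    l.diffSet c = M.nbhd i := by
  ext x
  constructor
  · rintro ⟨j, hj, hne⟩
    by_cases hji : j = i
    · exact hji ▸ hj
    · exact absurd (h.2 j hji) hne
  · intro hx
    exact ⟨i, hx, h.1⟩

theorem Only.unique {l : O.Labelling M} {c : ℕ} {i j : Fin M.m} (h : l.Only c i)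
    (h' : l.Only c j) : i = j := by
  by_contra hij
  exact h.1 (h'.2 i hij)

theorem not_only_zero (l : O.Labelling M) (i : Fin M.m) : ¬ l.Only 0 i := fun h => h.1 rfl

theorem exists_ne_of_ne_zero (l : O.Labelling M) {c : ℕ} (hc : c < O.k Finset.univ)
    (h0 : c ≠ 0) : ∃ i, l.state c i ≠ l.state 0 i := by
  by_contra! h
  exact h0 (l.inj c hc 0 l.pos (funext h))

theorem nbhd_subset_diffSet (l : O.Labelling M) {c : ℕ} {i : Fin M.m}
    (h : l.state c i ≠ l.state 0 i) : M.nbhd i ⊆ l.diffSet c := fun _ hx => ⟨i, hx, h⟩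

/-- Each variable in which the states differ contributes its whole neighbourhood to the difference
set; by SSC none but `i` fits into the neighbourhood of `i`. -/
theorem only_of_diffSet_subset (l : O.Labelling M) (hM : M.Admissible) {c : ℕ}
    (hc : c < O.k Finset.univ) (h0 : c ≠ 0) {i : Fin M.m} (h : l.diffSet c ⊆ M.nbhd i) :
    l.Only c i := by
  have key : ∀ j, l.state c j ≠ l.state 0 j → j = i := fun j hj => by
    by_contra hji
    exact hM.ssc j i hji ((l.nbhd_subset_diffSet hj).trans h)
  obtain ⟨j, hj⟩ := l.exists_ne_of_ne_zero hc h0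
  refine ⟨key j hj ▸ hj, fun j hji => ?_⟩
  by_contra hj
  exact hji (key j hj)

/-- All joint states occur among the components, so coordinates can be changed independently. -/
theorem exists_update (l : O.Labelling M) (c : ℕ) (i : Fin M.m) (v : Fin (M.dim i)) :
    ∃ c' < O.k Finset.univ, l.state c' i = v ∧ ∀ j, j ≠ i → l.state c' j = l.state c j := by
  obtain ⟨c', hc', h⟩ := l.surj (Function.update (l.state c) i v)
  refine ⟨c', hc', by simp [h], fun j hj => by simp [h, hj]⟩

theorem exists_only (l : O.Labelling M) (i : Fin M.m) :
    ∃ c < O.k Finset.univ, l.Only c i := by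
  have h2 := M.two_le_dim i
  have : Nontrivial (Fin (M.dim i)) := Fin.nontrivial_iff_two_le.2 h2
  obtain ⟨v, hv⟩ := exists_ne (l.state 0 i)
  obtain ⟨c, hc, h, h'⟩ := l.exists_update 0 i v
  exact ⟨c, hc, by rwa [h], h'⟩

/-- By the subset condition, the minimal nonempty difference sets are those of the components that
differ from the component `0` in a single hidden variable. -/
theorem minimal_iff (l : O.Labelling M) (hM : M.Admissible) {c : ℕ} (hc : c < O.k Finset.univ)
    (h0 : c ≠ 0) :
    (∀ c' < O.k Finset.univ, c' ≠ 0 → l.diffSet c' ⊆ l.diffSet c → l.diffSet c ⊆ l.diffSet c') ↔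
      ∃ i, l.Only c i := by
  constructor
  · intro h
    obtain ⟨i, hi⟩ := l.exists_ne_of_ne_zero hc h0
    obtain ⟨c', hc', ho⟩ := l.exists_only i
    have h0' : c' ≠ 0 := by
      rintro rfl
      exact l.not_only_zero i ho
    refine ⟨i, l.only_of_diffSet_subset hM hc h0 ?_⟩
    rw [← ho.diffSet_eq]
    refine h c' hc' h0' ?_
    rw [ho.diffSet_eq]
    exact l.nbhd_subset_diffSet hi
  · rintro ⟨i, ho⟩ c' hc' h0' hsub
    rw [ho.diffSet_eq] at hsub ⊢
    rw [(l.only_of_diffSet_subset hM hc' h0' hsub).diffSet_eq]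

/-- Recognizes the axis of `i` from the inclusions stored by the program. Component 0 is ruled out
because the neighbourhood of `i` is nonempty. -/
theorem only_iff_diffSet_eq (l : O.Labelling M) (hM : M.Admissible) {c c' : ℕ}
    (hc' : c' < O.k Finset.univ) {i : Fin M.m} (h : l.Only c i) :
    l.Only c' i ↔ l.diffSet c ⊆ l.diffSet c' ∧ l.diffSet c' ⊆ l.diffSet c := by
  constructor
  · intro h'
    rw [h.diffSet_eq, h'.diffSet_eq]
    exact ⟨subset_rfl, subset_rfl⟩
  · rintro ⟨h1, h2⟩
    rw [h.diffSet_eq] at h1 h2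
    refine l.only_of_diffSet_subset hM hc' ?_ h2
    rintro rfl
    obtain ⟨x, hx⟩ := hM.nbhd_nonempty i
    obtain ⟨j, -, hj⟩ := h1 hx
    exact hj rfl

/-- Enumerating the components that differ from the component `0` in the hidden variable `i` only
labels the values of this variable. -/
theorem exists_values (l : O.Labelling M) (i : Fin M.m) (p : ℕ → Prop) [DecidablePred p]
    (hp : ∀ c < O.k Finset.univ, p c ↔ l.Only c i) :
    1 + Nat.count p (O.k Finset.univ) = M.dim i ∧
    ∃ lab : Fin (M.dim i) → ℕ, Function.Injective lab ∧ (∀ v, lab v < M.dim i) ∧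
      lab (l.state 0 i) = 0 ∧
      ∀ c < O.k Finset.univ, l.Only c i → lab (l.state c i) = 1 + Nat.count p c := by
  classical
  -- `cv v` is the component on the axis of `i` with value `v`.
  choose cv hcv hval hoff using l.exists_update 0 i
  have honly : ∀ v, v ≠ l.state 0 i → l.Only (cv v) i := fun v hv => ⟨by rwa [hval], hoff v⟩
  have hinv : ∀ c < O.k Finset.univ, l.Only c i → cv (l.state c i) = c := fun c hc h => by
    refine l.inj _ (hcv _) c hc (funext fun j => ?_)
    by_cases hj : j = i
    · subst hj
      rw [hval]
    · rw [hoff _ j hj, h.2 j hj]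
  have hcount : 1 + Nat.count p (O.k Finset.univ) = M.dim i := by
    have : ((Finset.range (O.k Finset.univ)).filter p).card =
        (Finset.univ.erase (l.state 0 i)).card := by
      refine Finset.card_bij' (fun c _ => l.state c i) (fun v _ => cv v) ?_ ?_ ?_ ?_
      · intro c hc
        simp only [Finset.mem_filter, Finset.mem_range] at hc
        simpa using ((hp c hc.1).1 hc.2).1
      · intro v hv
        have hv : v ≠ l.state 0 i := by simpa using hv
        simp only [Finset.mem_filter, Finset.mem_range]
        exact ⟨hcv v, (hp _ (hcv v)).2 (honly v hv)⟩
      · intro c hc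
        simp only [Finset.mem_filter, Finset.mem_range] at hc
        exact hinv c hc.1 ((hp c hc.1).1 hc.2)
      · intro v _
        exact hval v
    rw [Nat.count_eq_card_filter_range, this, Finset.card_erase_of_mem (Finset.mem_univ _)]
    have := M.two_le_dim i
    simp only [Finset.card_univ, Fintype.card_fin]
    omega
  -- The origin's value gets 0, any other the rank of its component on the axis, counted from 1.
  refine ⟨hcount, fun v => if v = l.state 0 i then 0 else 1 + Nat.count p (cv v), ?_, ?_, ?_, ?_⟩
  · intro v w hvw
    simp only at hvw
    split_ifs at hvw with h1 h2 h2
    · rw [h1, h2]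
    · omega
    · omega
    · have : cv v = cv w := Nat.count_injective ((hp _ (hcv v)).2 (honly v h1))
        ((hp _ (hcv w)).2 (honly w h2)) (by omega)
      rw [← hval v, ← hval w, this]
  · intro v
    simp only
    have := M.two_le_dim i
    split_ifs with h
    · omega
    · have := Nat.count_strict_mono ((hp _ (hcv v)).2 (honly v h)) (hcv v)
      omega
  · simp
  · intro c hc h
    simp only
    rw [if_neg h.1, hinv c hc h]

end MixOracle.Labelling

/-! ### Finding the hidden variables -/

namespace Machine.Cmd

open LatentModel

variable {n : ℕ} {O : MixOracle n} {M : LatentModel n}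

open Classical in
/-- The state `s` contains the hidden variables in `L`, each of them with its number of values,
its neighbourhood, and a labelling of its values. -/
structure Found (l : O.Labelling M) (s : State) (L : List (Fin M.m)) : Prop where
  count : s.nat 0 0 0 = L.length
  nodup : L.Nodup
  dim : ∀ t i, L[t]? = some i → s.nat 1 0 t = M.dim i
  adj : ∀ t i, L[t]? = some i → ∀ x : Fin n, s.nat 2 x t = if x ∈ M.nbhd i then 1 else 0
  compl : ∀ t i, L[t]? = some i → ∀ x : Fin n, s.nat 11 t x = if x ∈ M.nbhd i then 0 else 1
  label : ∀ t i, L[t]? = some i → ∃ lab : Fin (M.dim i) → ℕ, Function.Injective lab ∧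
    (∀ v, lab v < M.dim i) ∧ ∀ c < O.k Finset.univ, s.nat 3 c t =
      if ∀ j, j ≠ i → l.state c j = l.state 0 j then lab (l.state c i) else 0
  rest : ∀ t, L.length ≤ t → ∀ c, s.nat 3 c t = 0
  mark : ∀ c < O.k Finset.univ, s.nat 17 c 0 ≠ 0 ↔ c = 0 ∨ ∃ i ∈ L, l.Only c i

open Classical in
-- The components with the same difference set as `c` are those on the axis of `i`, so one pass
-- labels all values of `i` and marks the whole axis.
theorem Found.newCmd {l : O.Labelling M} (hM : M.Admissible) {s : State} {L : List (Fin M.m)}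
    (h : Found l s L) {c : ℕ} {i : Fin M.m} (hc : c < O.k Finset.univ) (hi : l.Only c i)
    (hiL : i ∉ L) (h30 : s.nat 30 0 0 = c) (h21 : s.nat 21 0 0 = O.k Finset.univ)
    (h20 : s.nat 20 0 0 = n)
    (h13 : ∀ x : Fin n, s.nat 13 c x = if x ∈ l.diffSet c then 1 else 0)
    (h15 : ∀ c < O.k Finset.univ, ∀ c' < O.k Finset.univ,
      s.nat 15 c c' = 0 ↔ l.diffSet c ⊆ l.diffSet c') :
    Found l (exec O newCmd s) (L ++ [i]) := by
  let p : ℕ → Prop := fun c' => s.nat 15 c c' = 0 ∧ s.nat 15 c' c = 0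
  have hp : ∀ c' < O.k Finset.univ, p c' ↔ l.Only c' i := fun c' hc' => by
    rw [l.only_iff_diffSet_eq hM hc' hi, ← h15 c hc c' hc', ← h15 c' hc' c hc]
  obtain ⟨n0, n1, n17, n3, n2, n11⟩ := exec_newCmd O s h30 h.count h21 h20 p (fun _ => Iff.rfl)
  obtain ⟨hdim, lab, hinj, hlt, hbase, hlab⟩ := l.exists_values i p hp
  have hcase : ∀ t j, (L ++ [i])[t]? = some j →
      (t < L.length ∧ L[t]? = some j) ∨ (t = L.length ∧ j = i) := by
    intro t j htj
    rcases lt_trichotomy t L.length with ht | ht | ht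
    · rw [List.getElem?_append_left ht] at htj
      exact .inl ⟨ht, htj⟩
    · subst ht
      rw [List.getElem?_concat_length] at htj
      exact .inr ⟨rfl, (Option.some.inj htj).symm⟩
    · rw [List.getElem?_eq_none (by simpa using ht)] at htj
      cases htj
  have hd : l.diffSet c = M.nbhd i := hi.diffSet_eq
  constructor
  · simpa using n0
  · rw [List.nodup_append]
    refine ⟨h.nodup, List.nodup_singleton i, ?_⟩
    rintro a ha b hb rfl
    exact hiL (by simpa using List.mem_singleton.1 hb ▸ ha)
  · intro t j htj
    rw [n1]
    rcases hcase t j htj with ⟨ht, hj⟩ | ⟨rfl, rfl⟩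
    · rw [if_neg (by omega), h.dim t j hj]
    · rw [if_pos rfl, hdim]
  · intro t j htj x
    rw [n2]
    rcases hcase t j htj with ⟨ht, hj⟩ | ⟨rfl, rfl⟩
    · rw [if_neg (by omega), h.adj t j hj]
    · rw [if_pos ⟨rfl, x.2⟩, h13, hd]
  · intro t j htj x
    rw [n11]
    rcases hcase t j htj with ⟨ht, hj⟩ | ⟨rfl, rfl⟩
    · rw [if_neg (by omega), h.compl t j hj]
    · rw [if_pos ⟨rfl, x.2⟩, h13, hd]
      split_ifs <;> rfl
  · intro t j htj
    rcases hcase t j htj with ⟨ht, hj⟩ | ⟨rfl, rfl⟩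
    · obtain ⟨lab', h1, h2, h3⟩ := h.label t j hj
      refine ⟨lab', h1, h2, fun c' hc' => ?_⟩
      rw [n3, if_neg (by omega), h3 c' hc']
    · refine ⟨lab, hinj, hlt, fun c' hc' => ?_⟩
      rw [n3, h.rest _ le_rfl]
      by_cases ho : l.Only c' j
      · rw [if_pos ⟨rfl, hc', (hp c' hc').2 ho⟩, if_pos ho.2, hlab c' hc' ho]
      -- The column is still blank here. Off the axis 0 is the default; on it, the state is that of
      -- the origin, whose value has label 0.
      · rw [if_neg (fun h' => ho ((hp c' hc').1 h'.2.2))]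
        split_ifs with hoff
        · have : l.state c' j = l.state 0 j := by
            by_contra hne
            exact ho ⟨hne, hoff⟩
          rw [this, hbase]
        · rfl
  · intro t ht c'
    simp only [List.length_append, List.length_singleton] at ht
    rw [n3, if_neg (by omega), h.rest t (by omega)]
  · intro c' hc'
    rw [n17]
    by_cases ho : l.Only c' i
    · rw [if_pos ⟨hc', (hp c' hc').2 ho⟩]
      exact iff_of_true one_ne_zero (.inr ⟨i, by simp, ho⟩)
    · rw [if_neg (fun h' => ho ((hp c' hc').1 h'.2)), h.mark c' hc']
      simp [or_and_right, exists_or, ho]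

open Classical in
-- Each unmarked component with minimal difference set lies on the axis of one new variable. Marks
-- prevent a second discovery, and every axis contains a component other than the origin, so none is
-- missed.
theorem exists_found (l : O.Labelling M) (hM : M.Admissible) {s : State}
    (h0 : s.nat 0 0 0 = 0) (h3 : ∀ c t, s.nat 3 c t = 0) (h17 : ∀ c j, s.nat 17 c j = 0)
    (h21 : s.nat 21 0 0 = O.k Finset.univ) (h20 : s.nat 20 0 0 = n)
    (h13 : ∀ c < O.k Finset.univ, ∀ x : Fin n,
      s.nat 13 c x = if x ∈ l.diffSet c then 1 else 0)
    (h15 : ∀ c < O.k Finset.univ, ∀ c' < O.k Finset.univ,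
      s.nat 15 c c' = 0 ↔ l.diffSet c ⊆ l.diffSet c')
    (h14 : ∀ c < O.k Finset.univ, s.nat 14 c 0 = 0 ↔ ∀ c' < O.k Finset.univ, c' ≠ 0 →
      l.diffSet c' ⊆ l.diffSet c → l.diffSet c ⊆ l.diffSet c') :
    ∃ L, Found l (exec O hiddenCmd s) L ∧ ∀ i, i ∈ L := by
  set s₀ := s.setNat 17 0 0 1 with hs₀
  have e : exec O hiddenCmd s = exec O (loop 30 21
      (cond (.sub (.lit 1) (.add (.read 14 (var 30) (.lit 0)) (.read 17 (var 30) (.lit 0))))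
        newCmd skip)) s₀ := by
    rw [hiddenCmd, exec]
    rfl
  have f₀ : ∀ a, a ≠ 17 → s₀.nat a = s.nat a := fun a ha => setNat_nat_of_ne ha
  have key : ∃ L, Found l (exec O hiddenCmd s) L ∧
      ∀ c < s₀.nat 21 0 0, ∀ i, l.Only c i → i ∈ L := by
    rw [e]
    refine exec_loop_induct (fun k s' => ∃ L, Found l s' L ∧ ∀ c < k, ∀ i, l.Only c i → i ∈ L)
      ?_ ?_
    · refine ⟨[], ?_, fun c hc => by omega⟩
      constructor
      all_goals try simp only [List.getElem?_nil, reduceCtorEq, false_imp_iff, implies_true]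
      · rw [setNat_nat_of_ne (by decide), f₀ 0 (by decide), h0]
        rfl
      · exact List.nodup_nil
      · intro t _ c
        rw [setNat_nat_of_ne (by decide), f₀ 3 (by decide), h3]
      · intro c _
        rw [setNat_nat_of_ne (by decide), hs₀, setNat_nat_self]
        simp [h17]
    · rintro k s' hk hk1 hfr ⟨L, hL, hall⟩
      rw [f₀ 21 (by decide), h21] at hk
      have g : ∀ a, a ≠ 17 → a ∉ (loop 30 21 (cond (.sub (.lit 1) (.add (.read 14 (var 30)
          (.lit 0)) (.read 17 (var 30) (.lit 0)))) newCmd skip)).writes → s'.nat a = s.nat a :=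
        fun a ha ha' => by rw [hfr a ha', f₀ a ha]
      have g13 := g 13 (by decide) (by decide)
      have g14 := g 14 (by decide) (by decide)
      have g15 := g 15 (by decide) (by decide)
      have g20 := g 20 (by decide) (by decide)
      have g21 := g 21 (by decide) (by decide)
      have hset : ∀ {s : State} {L}, Found l s L → Found l (s.setNat 30 0 0 (k + 1)) L := by
        intro s L h
        constructor
        all_goals try rw [setNat_nat_of_ne (by decide)]
        exacts [h.count, h.nodup, h.dim, h.adj, h.compl, h.label, h.rest, h.mark]
      have hcond : (1 - (s'.nat 14 k 0 + s'.nat 17 k 0) ≠ 0) ↔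
          s'.nat 14 k 0 = 0 ∧ ¬ s'.nat 17 k 0 ≠ 0 := by omega
      simp only [exec, Expr.eval, var, hk1]
      by_cases hk0 : k = 0
      · rw [if_neg]
        · refine ⟨L, hset hL, fun c hc i ho => ?_⟩
          obtain rfl : c = 0 := by omega
          exact absurd ho (l.not_only_zero i)
        · rw [hcond, hL.mark k hk]
          exact fun h => h.2 (.inl hk0)
      have h14k : s'.nat 14 k 0 = 0 ↔ ∃ i, l.Only k i := by
        rw [g14, h14 k hk, l.minimal_iff hM hk hk0]
      by_cases hcase : 1 - (s'.nat 14 k 0 + s'.nat 17 k 0) ≠ 0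
      · rw [if_pos hcase]
        rw [hcond, h14k, hL.mark k hk] at hcase
        obtain ⟨⟨i, hi⟩, hnot⟩ := hcase
        have hiL : i ∉ L := fun h => hnot (.inr ⟨i, h, hi⟩)
        refine ⟨L ++ [i], hset (hL.newCmd hM hk hi hiL hk1 (by rw [g21, h21]) (by rw [g20, h20])
          (by rw [g13]; exact h13 k hk) (by rw [g15]; exact h15)), fun c hc j hj => ?_⟩
        rcases Nat.lt_succ_iff_lt_or_eq.1 hc with h | rfl
        · exact List.mem_append_left _ (hall c h j hj)
        · rw [hj.unique hi]
          simp
      · rw [if_neg hcase]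
        rw [hcond, h14k, hL.mark k hk] at hcase
        refine ⟨L, hset hL, fun c hc j hj => ?_⟩
        rcases Nat.lt_succ_iff_lt_or_eq.1 hc with h | rfl
        · exact hall c h j hj
        · by_contra hjL
          refine hcase ⟨⟨j, hj⟩, ?_⟩
          rintro (h | ⟨i, hi, ho⟩)
          · exact hk0 h
          · exact hjL (hj.unique ho ▸ hi)
  obtain ⟨L, hL, hall⟩ := key
  refine ⟨L, hL, fun i => ?_⟩
  obtain ⟨c, hc, ho⟩ := l.exists_only i
  exact hall c (by rwa [f₀ 21 (by decide), h21]) i ho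

end Machine.Cmd

/-! ### Assembling the algorithm and bounding its time -/

namespace Machine.Cmd

open LatentModel

variable {n : ℕ} {O : MixOracle n} {M : LatentModel n}

/-- Finds the hidden variables and labels the components in which only one of them differs from
its value in the component `0`. -/
def searchCmd : Cmd :=
  seq (indexCmd 10 12 20) (seq diffCmd (seq subsetCmd (seq nonminimalCmd hiddenCmd)))

/-- Completes the labelling and stores the probabilities. -/
def tableCmd : Cmd := seq (indexCmd 11 18 0) (seq floodCmd weightCmd)

/-- The whole algorithm. -/
def mainCmd : Cmd :=
  seq (assign 20 (.lit 0) (.lit 0) (var 0))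
    (seq setsCmd (seq countCmd (seq searchCmd tableCmd)))

/-- The state after the number of components has been determined. -/
structure Ready (O : MixOracle n) (s : State) : Prop where
  num : s.nat 20 0 0 = n
  count : s.nat 21 0 0 = O.k Finset.univ
  full : s.readSet n 10 n = Finset.univ
  singleton : ∀ x : Fin n, s.readSet n 10 x = {x}
  hidden : s.nat 0 0 0 = 0
  zero : ∀ a, a ∉ [0, 10, 20, 21, 30] → ∀ i j, s.nat a i j = 0

theorem ready (O : MixOracle n) : Ready O
    (exec O countCmd (exec O setsCmd (exec O (assign 20 (.lit 0) (.lit 0) (var 0))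
      (initial n)))) := by
  set s₁ := exec O (assign 20 (.lit 0) (.lit 0) (var 0)) (initial n) with hs₁
  set s₂ := exec O setsCmd s₁ with hs₂
  have f₃ : ∀ a, a ∉ countCmd.writes → (exec O countCmd s₂).nat a = s₂.nat a := fun a ha =>
    exec_nat_of_notMem O _ ha s₂
  have f₂ : ∀ a, a ∉ setsCmd.writes → s₂.nat a = s₁.nat a := fun a ha =>
    exec_nat_of_notMem O _ ha s₁
  have h20 : s₁.nat 20 0 0 = n := by
    simp [hs₁, exec, Expr.eval, var, setNat_nat_self, initial]
  have h10 : ∀ i x, s₂.nat 10 i x = if x < n ∧ (i = n ∨ i = x) then 1 else 0 := by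
    intro i x
    rw [hs₂, exec_setsCmd, h20]
    have : s₁.nat 10 i x = 0 := by
      rw [hs₁, exec, setNat_nat_of_ne (by decide)]
      simp [initial]
    rw [this]
    exact if_congr (by grind) rfl rfl
  have hfull : s₂.readSet n 10 n = Finset.univ := by
    ext x
    simp [State.readSet, h10]
  have hread : ∀ r, (exec O countCmd s₂).readSet n 10 r = s₂.readSet n 10 r := fun r => by
    rw [State.readSet, State.readSet, f₃ 10 (by decide)]
  have h20' : s₂.nat 20 0 0 = n := by rw [f₂ 20 (by decide), h20]
  refine ⟨by rw [f₃ 20 (by decide), h20'], ?_, by rw [hread, hfull], fun x => ?_, ?_, ?_⟩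
  · simp only [countCmd, exec, Expr.eval, var, h20', hfull]
    rw [setNat_nat_of_ne (by decide), setNat_nat_self]
    simp
  · rw [hread]
    ext y
    simp only [State.readSet, h10, Finset.mem_filter, Finset.mem_univ, true_and,
      Finset.mem_singleton]
    have := x.2
    have := y.2
    rw [Fin.ext_iff]
    grind
  · simp only [countCmd, exec, Expr.eval, setNat_nat_self, and_self, if_true]
  · intro a ha i j
    simp only [List.mem_cons, List.not_mem_nil, or_false, not_or] at ha
    rw [f₃ a (by simp [countCmd, writes, ha]), f₂ a (by simp [setsCmd, writes, ha]), hs₁, exec,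
      setNat_nat_of_ne ha.2.2.1]
    simp [initial, ha.1]

theorem exec_searchCmd (l : O.Labelling M) (hM : M.Admissible) {s : State} (hs : Ready O s) :
    ∃ L, Found l (exec O searchCmd s) L ∧ ∀ i, i ∈ L := by
  classical
  set s₁ := exec O (indexCmd 10 12 20) s with hs₁
  set s₂ := exec O diffCmd s₁ with hs₂
  set s₃ := exec O subsetCmd s₂ with hs₃
  set s₄ := exec O nonminimalCmd s₃ with hs₄
  have e : exec O searchCmd s = exec O hiddenCmd s₄ := by
    simp only [searchCmd, exec, hs₁, hs₂, hs₃, hs₄]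
  have f₁ : ∀ a, a ∉ (indexCmd 10 12 20).writes → s₁.nat a = s.nat a := fun a ha =>
    exec_nat_of_notMem O _ ha s
  have f₂ : ∀ a, a ∉ diffCmd.writes → s₂.nat a = s₁.nat a := fun a ha =>
    exec_nat_of_notMem O _ ha s₁
  have f₃ : ∀ a, a ∉ subsetCmd.writes → s₃.nat a = s₂.nat a := fun a ha =>
    exec_nat_of_notMem O _ ha s₂
  have f₄ : ∀ a, a ∉ nonminimalCmd.writes → s₄.nat a = s₃.nat a := fun a ha =>
    exec_nat_of_notMem O _ ha s₃
  have f : ∀ a, a ∉ [12, 13, 14, 15, 30, 31, 32, 40] → s₄.nat a = s.nat a := fun a ha => by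
    simp only [List.mem_cons, List.not_mem_nil, or_false, not_or] at ha
    rw [f₄ a (by simp [nonminimalCmd, writes, ha]), f₃ a (by simp [subsetCmd, writes, ha]),
      f₂ a (by simp [diffCmd, writes, ha]), f₁ a (by simp [indexCmd, writes, ha])]
  have k₁ : s₁.nat 21 0 0 = O.k Finset.univ := by rw [f₁ 21 (by decide), hs.count]
  have n₁ : s₁.nat 20 0 0 = n := by rw [f₁ 20 (by decide), hs.num]
  have k₂ : s₂.nat 21 0 0 = O.k Finset.univ := by rw [f₂ 21 (by decide), k₁]
  have n₂ : s₂.nat 20 0 0 = n := by rw [f₂ 20 (by decide), n₁]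
  have k₃ : s₃.nat 21 0 0 = O.k Finset.univ := by rw [f₃ 21 (by decide), k₂]
  have h12 : ∀ x : Fin n, ∀ c < O.k Finset.univ, s₁.nat 12 x c = l.index {x} c :=
    fun x c hc => by
      rw [hs₁, exec_indexCmd O s hs.count (by rw [hs.num, hs.full]) l.index
        (fun S c hc => ⟨l.index_lt S c hc, l.marginal_iff S c hc⟩) (by decide) (by decide)
        (by rw [hs.num]; exact x.2) hc, hs.singleton]
  have h13 : ∀ c < O.k Finset.univ, ∀ x : Fin n,
      s₂.nat 13 c x = if x ∈ l.diffSet c then 1 else 0 := fun c hc x => by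
    rw [hs₂, exec_diffCmd O s₁ (by rwa [k₁]) (by rw [n₁]; exact x.2), h12 x c hc, h12 x 0 l.pos]
    have := l.index_singleton_eq_iff hc x
    by_cases hx : x ∈ l.diffSet c
    · rw [if_neg (fun h => this.1 h hx), if_pos hx]
    · rw [if_pos (this.2 hx), if_neg hx]
  have h15 : ∀ c < O.k Finset.univ, ∀ c' < O.k Finset.univ,
      s₃.nat 15 c c' = 0 ↔ l.diffSet c ⊆ l.diffSet c' := fun c hc c' hc' => by
    rw [hs₃, exec_subsetCmd O s₂ (fun i j => by
      rw [f₂ 15 (by decide), f₁ 15 (by decide), hs.zero 15 (by decide)]) (by rwa [k₂])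
      (by rwa [k₂]), n₂]
    constructor
    · intro h x hx
      have := h x x.2
      rw [h13 c hc, h13 c' hc', if_pos hx] at this
      by_contra hx'
      rw [if_neg hx'] at this
      omega
    · intro h x hx
      have e1 := h13 c hc ⟨x, hx⟩
      have e2 := h13 c' hc' ⟨x, hx⟩
      simp only at e1 e2
      rw [e1, e2]
      split_ifs with h1 h2
      · exact le_rfl
      · exact absurd (h h1) h2
      · exact Nat.zero_le _
      · exact le_rfl
  have h14 : ∀ c < O.k Finset.univ, s₄.nat 14 c 0 = 0 ↔ ∀ c' < O.k Finset.univ, c' ≠ 0 →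
      l.diffSet c' ⊆ l.diffSet c → l.diffSet c ⊆ l.diffSet c' := fun c hc => by
    rw [hs₄, exec_nonminimalCmd O s₃ (fun i j => by
      rw [f₃ 14 (by decide), f₂ 14 (by decide), f₁ 14 (by decide), hs.zero 14 (by decide)])
      (by rwa [k₃]), k₃]
    refine forall₂_congr fun c' hc' => ?_
    rw [h15 c' hc' c hc, h15 c hc c' hc']
  rw [e]
  refine exists_found l hM (by rw [f 0 (by decide), hs.hidden])
    (fun c t => by rw [f 3 (by decide), hs.zero 3 (by decide)])
    (fun c t => by rw [f 17 (by decide), hs.zero 17 (by decide)])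
    (by rw [f 21 (by decide), hs.count]) (by rw [f 20 (by decide), hs.num]) ?_ ?_ h14
  · rw [f₄ 13 (by decide), f₃ 13 (by decide)]
    exact h13
  · rw [f₄ 15 (by decide)]
    exact h15

/-- The final state lists the joint hidden states, in the order of the components. -/
theorem exec_tableCmd (l : O.Labelling M) (hM : M.Admissible) {s : State} {L : List (Fin M.m)}
    (hL : Found l s L) (hall : ∀ i, i ∈ L) (h20 : s.nat 20 0 0 = n)
    (h21 : s.nat 21 0 0 = O.k Finset.univ) (hfull : s.readSet n 10 n = Finset.univ) :
    (∀ t i, L[t]? = some i → ∃ lab : Fin (M.dim i) → ℕ, Function.Injective lab ∧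
      (∀ v, lab v < M.dim i) ∧
      ∀ c < O.k Finset.univ, (exec O tableCmd s).nat 3 c t = lab (l.state c i)) ∧
    ∀ c < O.k Finset.univ, (exec O tableCmd s).real 0 0 c = M.hiddenProb (l.state c) := by
  classical
  set s₁ := exec O (indexCmd 11 18 0) s with hs₁
  set s₂ := exec O floodCmd s₁ with hs₂
  have e : exec O tableCmd s = exec O weightCmd s₂ := by
    simp only [tableCmd, exec, hs₁, hs₂]
  have f₁ : ∀ a, a ∉ (indexCmd 11 18 0).writes → s₁.nat a = s.nat a := fun a ha =>
    exec_nat_of_notMem O _ ha s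
  have f₂ : ∀ a, a ∉ floodCmd.writes → s₂.nat a = s₁.nat a := fun a ha =>
    exec_nat_of_notMem O _ ha s₁
  have f₃ : ∀ a, a ∉ weightCmd.writes → (exec O tableCmd s).nat a = s₂.nat a := fun a ha => by
    rw [e]; exact exec_nat_of_notMem O _ ha s₂
  have h18 : ∀ t i, L[t]? = some i → ∀ c < O.k Finset.univ, ∀ c' < O.k Finset.univ,
      s₁.nat 18 t c = s₁.nat 18 t c' ↔ ∀ j, j ≠ i → l.state c j = l.state c' j := by
    intro t i hti c hc c' hc'
    have ht : t < s.nat 0 0 0 := by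
      rw [hL.count]
      exact (List.getElem?_eq_some_iff.1 hti).1
    have key : ∀ c < O.k Finset.univ, s₁.nat 18 t c = l.index (s.readSet n 11 t) c :=
      fun c hc => by
        rw [hs₁, exec_indexCmd O s h21 (by rw [h20, hfull]) l.index
          (fun S c hc => ⟨l.index_lt S c hc, l.marginal_iff S c hc⟩) (by decide) (by decide) ht hc]
    rw [key c hc, key c' hc']
    refine l.index_compl_eq_iff hM (fun x => ?_) hc hc'
    simp only [State.readSet, Finset.mem_filter, Finset.mem_univ, true_and,
      hL.compl t i hti]
    split_ifs with h <;> simp [h]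
  have hex : ∀ t (ht : t < L.length), ∃ lab : Fin (M.dim L[t]) → ℕ, Function.Injective lab ∧
      (∀ v, lab v < M.dim L[t]) ∧ ∀ c < O.k Finset.univ, s.nat 3 c t =
      if ∀ j, j ≠ L[t] → l.state c j = l.state 0 j then lab (l.state c L[t]) else 0 :=
    fun t ht => hL.label t L[t] (List.getElem?_eq_getElem ht)
  choose lab hinj hlt hlab using hex
  let T : ℕ → ℕ → ℕ := fun c t => if ht : t < L.length then lab t ht (l.state c L[t]) else 0
  have hT : ∀ c t (ht : t < L.length), T c t = lab t ht (l.state c L[t]) := fun c t ht =>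
    dif_pos ht
  have h3 : s₁.nat 3 = s.nat 3 := f₁ 3 (by decide)
  have hne : ∀ t j (ht : t < L.length) (hj : j < L.length), t ≠ j → L[t] ≠ L[j] :=
    fun t j ht hj htj h => htj ((hL.nodup.getElem_inj_iff).1 h)
  have hflood : ∀ t < L.length, ∀ c < O.k Finset.univ, s₂.nat 3 c t = T c t := by
    intro t ht c hc
    refine exec_floodCmd O s₁ (by rw [f₁ 0 (by decide), hL.count])
      (by rw [f₁ 21 (by decide), h21]) T
      -- Layer `k` consists of the states that agree with the origin in all listed variables from
      -- `k` on, except possibly `t`. Layer 0 is the axis of `t`; layer `L.length` contains all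
      -- states.
      (fun t k c => ∀ j (hj : j < L.length), k ≤ j → j ≠ t → l.state c L[j] = l.state 0 L[j])
      ?_ ?_ ?_ ?_ ?_ ht hc
    · intro t ht c hc
      rw [h3, hlab t ht c hc, hT c t ht]
      split_ifs
      · exact .inr rfl
      · exact .inl rfl
    · intro t ht j hj htj c hc c' hc' h
      rw [h18 j L[j] (List.getElem?_eq_getElem hj) c hc c' hc'] at h
      rw [hT c t ht, hT c' t ht, h _ (hne t j ht hj htj)]
    · intro t ht c hc h
      rw [h3, hlab t ht c hc, hT c t ht, if_pos]
      intro i hi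
      obtain ⟨j, hj, rfl⟩ := List.getElem_of_mem (hall i)
      refine h j hj (Nat.zero_le j) ?_
      rintro rfl
      exact hi rfl
    · intro t ht j hj c hc h
      by_cases htj : t = j
      · refine ⟨c, hc, fun j' hj' hle hne' => h j' hj' ?_ hne', .inl rfl⟩
        omega
      -- Resetting coordinate `j` to the origin's value leads back to the previous layer.
      · obtain ⟨c', hc', hv, hoff⟩ := l.exists_update c L[j] (l.state 0 L[j])
        refine ⟨c', hc', fun j' hj' hle hne' => ?_, .inr ⟨htj, ?_⟩⟩
        · by_cases hjj : j' = j
          · subst hjj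
            exact hv
          · rw [hoff _ (hne j' j hj' hj hjj)]
            exact h j' hj' (by omega) hne'
        · rw [h18 j L[j] (List.getElem?_eq_getElem hj) c hc c' hc']
          exact fun i hi => (hoff i hi).symm
    · intro t ht c hc j hj hle
      omega
  refine ⟨fun t i hti => ?_, fun c hc => ?_⟩
  · obtain ⟨ht, rfl⟩ := List.getElem?_eq_some_iff.1 hti
    refine ⟨lab t ht, hinj t ht, hlt t ht, fun c hc => ?_⟩
    rw [f₃ 3 (by decide), hflood t ht c hc, hT c t ht]
  · have g20 : s₂.nat 20 0 0 = n := by rw [f₂ 20 (by decide), f₁ 20 (by decide), h20]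
    have g10 : s₂.readSet n 10 n = Finset.univ := by
      rw [← hfull, State.readSet, State.readSet, f₂ 10 (by decide), f₁ 10 (by decide)]
    rw [e, exec_weightCmd O s₂ (by rwa [f₂ 21 (by decide), f₁ 21 (by decide), h21]), g20, g10,
      l.weight_eq c hc]

/-- The hidden states in the order of the components. -/
noncomputable def _root_.MixOracle.Labelling.stateEquiv (l : O.Labelling M) :
    Fin (O.k Finset.univ) ≃ M.States :=
  Equiv.ofBijective (fun c => l.state c)
    ⟨fun c c' h => Fin.ext (l.inj c c.2 c' c'.2 h), fun h => by
      obtain ⟨c, hc, rfl⟩ := l.surj h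
      exact ⟨⟨c, hc⟩, rfl⟩⟩

theorem _root_.MixOracle.Labelling.k_eq_card (l : O.Labelling M) :
    O.k Finset.univ = Fintype.card M.States := by
  simpa using Fintype.card_congr l.stateEquiv

/-- The hidden variables, their neighbourhoods and a complete labelling of the components make up
a reconstruction. -/
theorem exists_outputs (l : O.Labelling M) {s : State} {L : List (Fin M.m)} (hnodup : L.Nodup)
    (hall : ∀ i, i ∈ L) (hcount : s.nat 0 0 0 = L.length)
    (hdim : ∀ t i, L[t]? = some i → s.nat 1 0 t = M.dim i)
    (hadj : ∀ t i, L[t]? = some i → ∀ x : Fin n, s.nat 2 x t ≤ 1 ∧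
      (s.nat 2 x t ≠ 0 ↔ x ∈ M.nbhd i))
    (hlabel : ∀ t i, L[t]? = some i → ∃ lab : Fin (M.dim i) → ℕ, Function.Injective lab ∧
      (∀ v, lab v < M.dim i) ∧ ∀ c < O.k Finset.univ, s.nat 3 c t = lab (l.state c i))
    (hprob : ∀ c < O.k Finset.univ, s.real 0 0 c = M.hiddenProb (l.state c)) :
    ∃ R : Reconstruction n, s.Outputs R ∧ R.Recovers M := by
  classical
  have hlen : L.length = M.m := by
    have h1 : L.toFinset = Finset.univ := by
      ext i
      simp [hall i]
    rw [← List.toFinset_card_of_nodup hnodup, h1]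
    simp
  let σ : Fin M.m ≃ Fin M.m := Equiv.ofBijective (fun t => L[t.1]'(hlen.symm ▸ t.2)) <| by
    refine Finite.injective_iff_bijective.1 fun t t' h => Fin.ext ?_
    exact (hnodup.getElem_inj_iff).1 h
  have hσ : ∀ t : Fin M.m, L[t.1]? = some (σ t) := fun t =>
    List.getElem?_eq_getElem (hlen.symm ▸ t.2)
  choose lab hinj hlt hlab using fun t : Fin M.m => hlabel t (σ t) (hσ t)
  -- The values of the reconstruction are the stored labels, so `τ` inverts the labelling.
  let τ : ∀ t : Fin M.m, Fin (M.dim (σ t)) ≃ Fin (M.dim (σ t)) := fun t =>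
    (Equiv.ofBijective (fun v => (⟨lab t v, hlt t v⟩ : Fin (M.dim (σ t))))
      (Finite.injective_iff_bijective.1 fun v w h => hinj t (Fin.ext_iff.1 h))).symm
  have hτ : ∀ t v, ((τ t).symm v : ℕ) = lab t v := fun t v => rfl
  let E : (∀ t, Fin (M.dim (σ t))) ≃ M.States := Equiv.piCongr σ τ
  let R : Reconstruction n :=
    { m := M.m
      dim := fun t => M.dim (σ t)
      adj := fun x t => x ∈ M.nbhd (σ t)
      prob := fun g => M.hiddenProb (E g) }
  have hK : O.k Finset.univ = ∏ t, M.dim (σ t) := by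
    rw [l.k_eq_card, ← Fintype.card_congr E]
    simp
  refine ⟨R, ⟨hcount.trans hlen, fun t => hdim t _ (hσ t), fun x t => ?_,
    E.trans (l.stateEquiv.symm.trans (finCongr hK)), fun g => ?_⟩, σ, τ, fun x t => Iff.rfl,
    fun h => ?_⟩
  · obtain ⟨h1, h2⟩ := hadj t _ (hσ t) x
    split_ifs with h
    · have := h2.2 h
      omega
    · by_contra h0
      exact h (h2.1 h0)
  · set c := l.stateEquiv.symm (E g) with hc
    have hrow : ((E.trans (l.stateEquiv.symm.trans (finCongr hK))) g : ℕ) = c.1 := rfl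
    have hstate : l.state c = E g := l.stateEquiv.apply_symm_apply (E g)
    rw [hrow]
    refine ⟨fun t => ?_, ?_⟩
    · rw [hlab t c c.2, hstate, ← hτ]
      have : E g (σ t) = τ t (g t) := 
        Equiv.piCongr_apply_apply (Z := fun i => Fin (M.dim i)) σ τ g t
      rw [this, Equiv.symm_apply_apply]
    · rw [hprob c c.2, hstate]
  · show M.hiddenProb (E _) = _
    have : (fun t => (τ t).symm (h (σ t))) = E.symm h := by
      rw [Equiv.piCongr_symm_apply]
    rw [this, Equiv.apply_symm_apply]

theorem exec_mainCmd_outputs (l : O.Labelling M) (hM : M.Admissible) :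
    ∃ R : Reconstruction n, (exec O mainCmd (initial n)).Outputs R ∧ R.Recovers M := by
  set s := exec O countCmd (exec O setsCmd (exec O (assign 20 (.lit 0) (.lit 0) (var 0))
      (initial n))) with hs
  have hr : Ready O s := ready O
  have e : exec O mainCmd (initial n) = exec O tableCmd (exec O searchCmd s) := by
    simp only [mainCmd, exec, hs]
  obtain ⟨L, hL, hall⟩ := exec_searchCmd l hM hr
  have f₁ : ∀ a, a ∉ searchCmd.writes → (exec O searchCmd s).nat a = s.nat a := fun a ha =>
    exec_nat_of_notMem O _ ha s
  have f₂ : ∀ a, a ∉ tableCmd.writes → (exec O tableCmd (exec O searchCmd s)).nat a =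
      (exec O searchCmd s).nat a := fun a ha => exec_nat_of_notMem O _ ha _
  obtain ⟨hlabel, hprob⟩ := exec_tableCmd l hM hL hall (by rw [f₁ 20 (by decide), hr.num])
    (by rw [f₁ 21 (by decide), hr.count])
    (by rw [← hr.full, State.readSet, State.readSet, f₁ 10 (by decide)])
  rw [e]
  refine exists_outputs l hL.nodup hall (by rw [f₂ 0 (by decide), hL.count])
    (by rw [f₂ 1 (by decide)]; exact hL.dim) (fun t i hti x => ?_) hlabel hprob
  rw [f₂ 2 (by decide), hL.adj t i hti]
  split_ifs with h <;> simp [h]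

/-- Makes loops over the hidden variables affordable: each has at least two values, so 2^m ≤ K. -/
theorem hiddenCount_le_card (M : LatentModel n) : M.m ≤ Fintype.card M.States := by
  have h : 2 ^ M.m ≤ Fintype.card M.States := by
    rw [Fintype.card_pi]
    simpa using Finset.prod_le_prod' (s := Finset.univ) fun i (_ : i ∈ _) => M.two_le_dim i
  exact (Nat.lt_two_pow_self).le.trans h

/-- `run_compile` requires loop bounds that the command does not write, while the program itself
computes n, K and m as bounds. It is therefore run in blocks, each computing bounds before the
blocks that use them. -/
theorem exists_run_mainCmd (l : O.Labelling M) (hM : M.Admissible) :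
    ∃ t ≤ mainCmd.cost.eval (n + Fintype.card M.States),
      Run O mainCmd.compile (initial n) t (exec O mainCmd (initial n)) := by
  set B := n + Fintype.card M.States with hB
  have hn : n ≤ B := by omega
  set s₁ := exec O (assign 20 (.lit 0) (.lit 0) (var 0)) (initial n) with hs₁
  set s₂ := exec O setsCmd s₁ with hs₂
  set s₃ := exec O countCmd s₂ with hs₃
  set s₄ := exec O searchCmd s₃ with hs₄
  have hr : Ready O s₃ := ready O
  obtain ⟨L, hL, hall⟩ := exec_searchCmd l hM hr
  have h20 : s₁.nat 20 0 0 = n := by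
    simp [hs₁, exec, Expr.eval, var, setNat_nat_self, initial]
  have h21 : s₃.nat 21 0 0 ≤ B := by
    rw [hr.count, l.k_eq_card]
    omega
  have f₄ : ∀ a, a ∉ searchCmd.writes → s₄.nat a = s₃.nat a := fun a ha =>
    exec_nat_of_notMem O _ ha s₃
  have h0 : s₄.nat 0 0 0 ≤ B := by
    have h1 : L.length ≤ M.m := by simpa using hL.nodup.length_le_card
    have h2 := hiddenCount_le_card M
    rw [hL.count]
    omega
  obtain ⟨t₁, ht₁, r₁⟩ := run_compile O hn (assign 20 (.lit 0) (.lit 0) (var 0)) (initial n) rfl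
    (by simp [bounds])
  obtain ⟨t₂, ht₂, r₂⟩ := run_compile O hn setsCmd s₁ (by decide)
    (by simp [bounds, writes, setsCmd, h20, hn])
  obtain ⟨t₃, ht₃, r₃⟩ := run_compile O hn countCmd s₂ (by decide) (by simp [bounds, countCmd])
  obtain ⟨t₄, ht₄, r₄⟩ := run_compile O hn searchCmd s₃ (by decide) (by
    intro b hb
    have hb' : b = 20 ∨ b = 21 := by
      have : ∀ b ∈ searchCmd.bounds, b = 20 ∨ b = 21 := by decide
      exact this b hb
    rcases hb' with rfl | rfl
    · exact ⟨by decide, by rw [hr.num]; exact hn⟩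
    · exact ⟨by decide, h21⟩)
  obtain ⟨t₅, ht₅, r₅⟩ := run_compile O hn tableCmd s₄ (by decide) (by
    intro b hb
    have hb' : b = 0 ∨ b = 21 := by
      have : ∀ b ∈ tableCmd.bounds, b = 0 ∨ b = 21 := by decide
      exact this b hb
    rcases hb' with rfl | rfl
    · exact ⟨by decide, h0⟩
    · exact ⟨by decide, by rw [f₄ 21 (by decide)]; exact h21⟩)
  refine ⟨t₁ + (t₂ + (t₃ + (t₄ + t₅))), ?_, ?_⟩
  · simp only [mainCmd, cost, Polynomial.eval_add] at *
    omega
  · have e : exec O mainCmd (initial n) = exec O tableCmd s₄ := by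
      simp only [mainCmd, exec, hs₁, hs₂, hs₃, hs₄]
    rw [e]
    exact .seq r₁ (.seq r₂ (.seq r₃ (.seq r₄ r₅)))

end Machine.Cmd

/-! ### Uniqueness of the output and the theorem -/

/-- A state contains at most one reconstruction. -/
theorem Machine.State.Outputs.unique {n : ℕ} {s : Machine.State} {R R' : Reconstruction n}
    (h : s.Outputs R) (h' : s.Outputs R') : R = R' := by
  obtain ⟨m, dim, adj, prob⟩ := R
  obtain ⟨m', dim', adj', prob'⟩ := R'
  obtain ⟨h1, h2, h3, row, h4⟩ := h
  obtain ⟨h1', h2', h3', row', h4'⟩ := h'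
  simp only at h1 h2 h3 h4 h1' h2' h3' h4'
  obtain rfl : m = m' := h1.symm.trans h1'
  obtain rfl : dim = dim' := funext fun i => (h2 i).symm.trans (h2' i)
  obtain rfl : adj = adj' := by
    funext x i
    have := (h3 x i).symm.trans (h3' x i)
    refine propext ?_
    split_ifs at this with ha hb hb <;> simp_all
  obtain rfl : prob = prob' := by
    funext g
    obtain ⟨g', hg'⟩ := row'.surjective (row g)
    have : g' = g := funext fun i => Fin.ext <| by
      rw [← (h4 g).1 i, ← (h4' g').1 i, hg']
    rw [← (h4 g).2, ← hg', (h4' g').2, this]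
  rfl

theorem theorem1 :
    (∃ reconstruct : ∀ n : ℕ,
        MeasureTheory.Measure (Fin n → ℝ) → MixOracle n → Reconstruction n,
      ∀ (n : ℕ) (M : LatentModel n), M.Admissible →
        ∀ O : MixOracle n, O.IsOracleFor M →
          (reconstruct n M.obsLaw O).Recovers M) ∧
    (∃ (prog : Machine.Program) (p : Polynomial ℕ),
      ∀ (n : ℕ) (M : LatentModel n), M.Admissible →
        LinearIndependent ℝ (fun i : Fin M.m => M.adjMatrix.col i) →
        ∀ O : MixOracle n, O.IsOracleFor M →
          ∃ (t : ℕ) (s : Machine.State) (R : Reconstruction n),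
            Machine.Run O prog (Machine.initial n) t s ∧
            t ≤ p.eval (n + Fintype.card M.States) ∧
            s.Outputs R ∧ R.Recovers M) := by
  classical
  have hempty : ∀ n, Nonempty (Reconstruction n) := fun n =>
    ⟨⟨0, fun _ => 0, fun _ _ => False, fun _ => 0⟩⟩
  -- The chosen reconstruction is defined from the oracle alone, through the final state of the
  -- program. Since a state contains at most one reconstruction, the choice is the correct one.
  refine ⟨⟨fun n _ O => Classical.epsilon
    fun R => (Machine.Cmd.exec O Machine.Cmd.mainCmd (Machine.initial n)).Outputs R,
    fun n M hM O hO => ?_⟩, Machine.Cmd.mainCmd.compile, Machine.Cmd.mainCmd.cost,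
    fun n M hM _ O hO => ?_⟩
  · obtain ⟨l⟩ := hO.exists_labelling hM
    obtain ⟨R, hR, hRM⟩ := Machine.Cmd.exec_mainCmd_outputs l hM
    have := Classical.epsilon_spec (p := fun R =>
      (Machine.Cmd.exec O Machine.Cmd.mainCmd (Machine.initial n)).Outputs R) ⟨R, hR⟩
    rw [← this.unique hR] at hRM
    exact hRM
  · obtain ⟨l⟩ := hO.exists_labelling hM
    obtain ⟨R, hR, hRM⟩ := Machine.Cmd.exec_mainCmd_outputs l hM
    obtain ⟨t, ht, hrun⟩ := Machine.Cmd.exists_run_mainCmd l hM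
    exact ⟨t, _, R, hrun, ht, hR, hRM⟩
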